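/- Let $f:\mathbb R\to\mathbb R$ satisfy: (1) $f$ is absolutely continuous and $2\pi$-periodic; (2) $f$ is differentiable except possibly at finitely many points per period, none of which is an integer multiple of $\pi$; (3) $c=f'(0)\neq 0$ and $f(x)=cx+O(|x|^{1+\delta})$ as $x\to0$ for some $\delta>0$; (4) $f(x+\pi)=-f(x)$ and $f(-x)=-f(x)$ for all $x$, and $f(x)>0$ for $x\in(0,\pi)$. Let $0<\varepsilon<2/c$. Let $c^\pm\in\mathbb C\setminus\{0\}$, put $$p(\pm x)=c^{\pm}\exp\Big(\int_{\pm\pi/2}^{\pm x}\Big(\frac{f'(y)}{f(y)}+\frac1{\varepsilon f(y)}\Big)dy\Big)\quad(0<x<\pi),\qquad w=\frac pf,\qquad \psi=\frac1w ,$$ and define on $(-\pi,\pi)^2$ $$G(x,y)=\begin{cases}1-\psi(x)/\psi(y), & 0<y<x,\\ -(1-\psi(x)/\psi(y)), & x<y<0,\\ 0,&\text{otherwise.}\end{cases}$$ Let $\ell_\varepsilon[u]=\varepsilon(fu')'+u'$. Let $L_\varepsilon$ be the operator $L_\varepsilon u=\ell_\varepsilon[u]$ in $L^2(-\pi,\pi)$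 (complex-valued functions) whose domain consists of all $u\in L^2(-\pi,\pi)$ (that is, having a representative) such that $u$ is absolutely continuous on every compact subinterval of $(-\pi,\pi)$, $fu'+u$ is absolutely continuous on every compact subinterval of $(-\pi,0)\cup(0,\pi)$, $\ell_\varepsilon[u]\in L^2(-\pi,\pi)$, and the limits $\lim_{x\to\pi^-}u(x)$ and $\lim_{x\to-\pi^+}u(x)$ exist and are equal. For $p>0$ let $\mathcal C_p$ be the Schatten–von Neumann class of compact operators $A$ whose singular values (the positive square roots of the positive eigenvalues of $A^*A$, repeated according to multiplicity) are $p$-summable. Then: (a) $TF(x)=\int_{-\pi}^{\pi}G(x,y)F(y)\,dy$ defines a bounded operator $T$ on $L^2(-\pi,\pi)$, the integral converging absolutely for almost every $x$, and $T\in\mathcal C_p$ for every $p>2/3$. (b) The resolvent set of $L_\varepsilon$ is non-empty, and for every $z$ in it the resolvent $(L_\varepsilon-z)^{-1}$ lies in $\mathcal C_p$ for every $p>2/3$. -/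

import Mathlib

open MeasureTheory Set Filter Topology Asymptotics

namespace SingularSL

/-- The standing assumptions (1)-(4) on the coefficient `f`. A periodic function is absolutely
continuous iff it is so on every compact interval, and the finitely many exceptional points of
(2) are counted in one period. -/
structure Coefficient (f : ℝ → ℝ) : Prop where
  absCont : ∀ a b : ℝ, AbsolutelyContinuousOnInterval f a b
  periodic : Function.Periodic f (2 * Real.pi)
  finite_nondiff : {x ∈ Ico (-Real.pi) Real.pi | ¬ DifferentiableAt ℝ f x}.Finite
  diff_int_mul_pi : ∀ k : ℤ, DifferentiableAt ℝ f (k * Real.pi)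
  deriv_zero_ne : deriv f 0 ≠ 0
  expansion : ∃ δ : ℝ, 0 < δ ∧
    (fun x => f x - deriv f 0 * x) =O[𝓝 0] fun x => |x| ^ (1 + δ)
  antiperiodic : ∀ x, f (x + Real.pi) = -f x
  odd : ∀ x, f (-x) = -f x
  pos : ∀ x ∈ Ioo 0 Real.pi, 0 < f x

/-- Lebesgue measure on `(-π, π)`. -/
noncomputable abbrev circMeasure : Measure ℝ := volume.restrict (Ioo (-Real.pi) Real.pi)

/-- The complex Hilbert space `L²(-π, π)`. -/
abbrev L2 : Type := Lp ℂ 2 circMeasure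

/-- `T` belongs to the Schatten-von Neumann class `C_p`: `T` is compact and its singular values
(the positive numbers `s` such that `s²` is an eigenvalue of `T* T`), repeated according to
multiplicity, are `p`-summable. -/
def IsSchatten {H : Type*} [NormedAddCommGroup H] [InnerProductSpace ℂ H] [CompleteSpace H]
    (p : ℝ) (T : H →L[ℂ] H) : Prop :=
  IsCompactOperator T ∧
    Summable fun s : Ioi (0 : ℝ) =>
      (Module.finrank ℂ (Module.End.eigenspace
        ((ContinuousLinearMap.adjoint T ∘L T : H →L[ℂ] H) : H →ₗ[ℂ] H)
        (((s : ℝ) ^ 2 : ℝ) : ℂ)) : ℝ) * (s : ℝ) ^ p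

/-- The integrating factor `p` on `(-π, 0) ∪ (0, π)`, a solution of `p'/p = f'/f + 1/(ε f)`, with
the free constants `cp` on `(0, π)` and `cm` on `(-π, 0)`. -/
noncomputable def integratingFactor (f : ℝ → ℝ) (ε : ℝ) (cp cm : ℂ) (x : ℝ) : ℂ :=
  if 0 < x then
    cp * ((Real.exp (∫ y in (Real.pi / 2)..x, (deriv f y / f y + 1 / (ε * f y))) : ℝ) : ℂ)
  else
    cm * ((Real.exp (∫ y in (-(Real.pi / 2))..x, (deriv f y / f y + 1 / (ε * f y))) : ℝ) : ℂ)

/-- The weight `w = p / f`. -/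
noncomputable def weight (f : ℝ → ℝ) (ε : ℝ) (cp cm : ℂ) (x : ℝ) : ℂ :=
  integratingFactor f ε cp cm x / (f x : ℂ)

/-- The second solution `ψ = 1 / w` of the homogeneous equation. -/
noncomputable def psi (f : ℝ → ℝ) (ε : ℝ) (cp cm : ℂ) (x : ℝ) : ℂ :=
  1 / weight f ε cp cm x

open Classical in
/-- The Green's kernel `G(x, y)`. -/
noncomputable def greenKernel (f : ℝ → ℝ) (ε : ℝ) (cp cm : ℂ) (x y : ℝ) : ℂ :=
  if 0 < y ∧ y < x then 1 - psi f ε cp cm x / psi f ε cp cm y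
  else if x < y ∧ y < 0 then -(1 - psi f ε cp cm x / psi f ε cp cm y)
  else 0

/-- `T` is the integral operator on `L²(-π, π)` with kernel `G`; the integrals converge. -/
def IsIntegralOperator (G : ℝ → ℝ → ℂ) (T : L2 →L[ℂ] L2) : Prop :=
  ∀ F : L2, ∀ᵐ x ∂circMeasure,
    Integrable (fun y => G x y * F y) circMeasure ∧ T F x = ∫ y, G x y * F y ∂circMeasure

/-- `u ∈ AC_loc(J)`: absolute continuity on every compact interval contained in `J`. -/
def ACLoc (u : ℝ → ℂ) (J : Set ℝ) : Prop :=
  ∀ a b : ℝ, a ≤ b → Icc a b ⊆ J → AbsolutelyContinuousOnInterval u a b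

/-- `u` is admissible: `u` and `f u' + u` lie in `AC_loc((-π, 0) ∪ (0, π))`. As `f` has no zero
there, this forces `u` to be continuously differentiable on `(-π, 0) ∪ (0, π)`. -/
def Admissible (f : ℝ → ℝ) (u : ℝ → ℂ) : Prop :=
  ACLoc u (Ioo (-Real.pi) 0 ∪ Ioo 0 Real.pi) ∧
    ACLoc (fun x => (f x : ℂ) * deriv u x + u x) (Ioo (-Real.pi) 0 ∪ Ioo 0 Real.pi)

/-- The differential expression `ℓ_ε[u] = ε (f u')' + u'`. -/
noncomputable def ell (f : ℝ → ℝ) (ε : ℝ) (u : ℝ → ℂ) (x : ℝ) : ℂ :=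
  (ε : ℂ) * deriv (fun t => (f t : ℂ) * deriv u t) x + deriv u x

/-- The graph of the operator `L_ε` in `L²(-π, π)`: `u ∈ Dom(L_ε)` and `L_ε u = F`. That is, `u`
is (represented by) an admissible function `v`, absolutely continuous across the singularity at
`0`, with `ℓ_ε[v] = F` almost everywhere, that satisfies the periodic boundary condition. -/
def LGraph (f : ℝ → ℝ) (ε : ℝ) (u F : L2) : Prop :=
  ∃ v : ℝ → ℂ, u =ᵐ[circMeasure] v ∧
    Admissible f v ∧ ACLoc v (Ioo (-Real.pi) Real.pi) ∧
    (∀ᵐ x ∂circMeasure, ell f ε v x = F x) ∧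
    ∃ l : ℂ, Tendsto v (𝓝[<] Real.pi) (𝓝 l) ∧ Tendsto v (𝓝[>] (-Real.pi)) (𝓝 l)

/-- `z` lies in the resolvent set of `L_ε` and `R = (L_ε - z)⁻¹`: the bounded operator `R` on
`L²(-π, π)` is inverse to the bijection `L_ε - z : Dom(L_ε) → L²(-π, π)`, i.e.
`u ∈ Dom(L_ε)` and `L_ε u - z u = g` if and only if `u = R g`. -/
def IsResolvent (f : ℝ → ℝ) (ε : ℝ) (z : ℂ) (R : L2 →L[ℂ] L2) : Prop :=
  ∀ u g : L2, LGraph f ε u (g + z • u) ↔ u = R g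

end SingularSL

/-! Write ω = `expPhase` for exp ∫ 1/(ε f), extended evenly. Integrating f'/f shows that the weight
p/f is a constant multiple of ω on each side of 0, so the constants c^± cancel from ψ(x)/ψ(y) =
ω(y)/ω(x), and the kernel is 1 - ω(y)/ω(x) for 0 < y < x, with an odd reflection in the opposite
quadrant. Since f is comparable to x near 0 and f(π - x) = f(x), ω increases from 0 to ∞ on (0, π).

Schatten bound for T. The kernel vanishes on the diagonal and is separable on either side of it. Cut
(-π, π) into 2n cells, symmetric about 0 and graded quadratically towards 0 and ±π. Off the diagonal
blocks the kernel agrees with an operator of rank at most 8n. On a block at distance a from the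
singularity it is at most (length)/(ε m a), because 1 - exp(-t) ≤ t and f ≥ m a there; the grading
makes the product with the measure of the cell O(n⁻²) uniformly in the cell
(`exists_graded_cell_bound`). A block diagonal operator is controlled by its worst block
(`L2_norm_le_of_cells`), so T is within O(n⁻²) of rank O(n): this is `QuadraticApprox`. Counting
singular values dyadically then gives the class C_p for every p > 1/2
(`QuadraticApprox.isSchatten`), hence for p > 2/3.

The resolvent. Integrating the equation gives ε f u' + u = const + ∫F, whose homogeneous solution
1/ω blows up at 0 and is excluded by continuity there. Thus u = u(0) + T F, and equality of the
limits at ±π says exactly that F has mean zero. Conversely, for F in L² of mean zero these functions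
lie in the domain; square integrability gives u' = O(|x|^(-1/2)) at 0, hence absolute continuity
across 0. So the graph of the operator is {(K + T F, F) : ∫F = 0} (`lGraph_iff`). With F = g + z u
this gives R = T(1 + zR) + (rank one), so R inherits the approximation property, while a Neumann
argument for small z ≠ 0 shows that the resolvent set is non-empty. -/

namespace SingularSL

/-! ### Approximation by finite rank operators and Schatten classes -/

section Schatten

variable {H : Type*} [NormedAddCommGroup H] [InnerProductSpace ℂ H]

/-- `T` can be approximated to order `n⁻²` in norm by operators of rank `O(n)`. -/
def QuadraticApprox (T : H →L[ℂ] H) : Prop :=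
  ∃ (C : ℝ) (K : ℕ), ∀ n : ℕ, 1 ≤ n → ∃ A : H →L[ℂ] H,
    (A : H →ₗ[ℂ] H).rank ≤ ((K * n : ℕ) : Cardinal) ∧ ‖T - A‖ ≤ C / (n : ℝ) ^ 2

theorem isCompactOperator_of_rank_le {A : H →L[ℂ] H} {N : ℕ}
    (hA : (A : H →ₗ[ℂ] H).rank ≤ (N : Cardinal)) : IsCompactOperator A := by
  have hfin : FiniteDimensional ℂ (LinearMap.range (A : H →ₗ[ℂ] H)) :=
    Module.rank_lt_aleph0_iff.mp (lt_of_le_of_lt hA (Cardinal.natCast_lt_aleph0))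
  let B : H →L[ℂ] LinearMap.range (A : H →ₗ[ℂ] H) :=
    A.codRestrict _ fun x => LinearMap.mem_range_self (A : H →ₗ[ℂ] H) x
  have hB : IsCompactOperator B :=
    haveI : ProperSpace (LinearMap.range (A : H →ₗ[ℂ] H)) := FiniteDimensional.proper ℂ _
    isCompactOperator_of_locallyCompactSpace_dom B
  exact hB.clm_comp (LinearMap.range (A : H →ₗ[ℂ] H)).subtypeL

theorem QuadraticApprox.comp_right {T : H →L[ℂ] H} (hT : QuadraticApprox T) (B : H →L[ℂ] H) :
    QuadraticApprox (T ∘L B) := by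
  obtain ⟨C, K, h⟩ := hT
  refine ⟨C * ‖B‖, K, fun n hn => ?_⟩
  obtain ⟨A, h1, h2⟩ := h n hn
  refine ⟨A ∘L B, ?_, ?_⟩
  · exact (LinearMap.rank_comp_le_left (B : H →ₗ[ℂ] H) (A : H →ₗ[ℂ] H)).trans h1
  · rw [← ContinuousLinearMap.sub_comp, mul_div_right_comm]
    exact (ContinuousLinearMap.opNorm_comp_le _ _).trans (by gcongr)

/-- A fixed rank N is at most N n once n ≥ 1, so it is absorbed in the rank constant. Together with
composition on the right, this carries the property from T to the resolvent. -/
theorem QuadraticApprox.add_rank {T B : H →L[ℂ] H} (hT : QuadraticApprox T) {N : ℕ}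
    (hB : (B : H →ₗ[ℂ] H).rank ≤ (N : Cardinal)) : QuadraticApprox (T + B) := by
  obtain ⟨C, K, h⟩ := hT
  refine ⟨C, K + N, fun n hn => ?_⟩
  obtain ⟨A, h1, h2⟩ := h n hn
  refine ⟨A + B, ?_, by simpa using h2⟩
  refine (LinearMap.rank_add_le (A : H →ₗ[ℂ] H) (B : H →ₗ[ℂ] H)).trans ((add_le_add h1 hB).trans ?_)
  norm_cast
  nlinarith

variable [CompleteSpace H]

theorem QuadraticApprox.isCompactOperator {T : H →L[ℂ] H} (hT : QuadraticApprox T) :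
    IsCompactOperator T := by
  obtain ⟨C, K, h⟩ := hT
  choose! A hr hn using h
  refine isCompactOperator_of_tendsto (F := A) (l := atTop) ?_ ?_
  · rw [tendsto_iff_norm_sub_tendsto_zero]
    have h0 : Tendsto (fun n : ℕ => C / (n : ℝ) ^ 2) atTop (𝓝 0) :=
      tendsto_const_nhds.div_atTop
        ((tendsto_pow_atTop two_ne_zero).comp tendsto_natCast_atTop_atTop)
    refine squeeze_zero' (Eventually.of_forall fun _ => norm_nonneg _) ?_ h0
    filter_upwards [eventually_ge_atTop 1] with n h1
    rw [norm_sub_rev]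
    exact hn n h1
  · filter_upwards [eventually_ge_atTop 1] with n h1
    exact isCompactOperator_of_rank_le (hr n h1)

/-- The eigenspace of `T* T` for the eigenvalue `s²`. -/
noncomputable abbrev singularSpace (T : H →L[ℂ] H) (s : ℝ) : Submodule ℂ H :=
  Module.End.eigenspace
    ((ContinuousLinearMap.adjoint T ∘L T : H →L[ℂ] H) : H →ₗ[ℂ] H) ((s ^ 2 : ℝ) : ℂ)

theorem adjoint_comp_self_isSymmetric (T : H →L[ℂ] H) :
    ((ContinuousLinearMap.adjoint T ∘L T : H →L[ℂ] H) : H →ₗ[ℂ] H).IsSymmetric := by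
  intro x y
  simp [ContinuousLinearMap.adjoint_inner_left, ContinuousLinearMap.adjoint_inner_right]

/-- Positivity makes s ↦ s² injective, so distinct s give distinct eigenvalues of a symmetric
operator. -/
theorem singularSpace_orthogonalFamily (T : H →L[ℂ] H) (S : Finset ℝ) (hS : ∀ s ∈ S, 0 < s) :
    OrthogonalFamily ℂ (fun s : S => singularSpace T s) fun s => (singularSpace T s).subtypeₗᵢ := by
  have h := (adjoint_comp_self_isSymmetric T).orthogonalFamily_eigenspaces
  have hinj : Function.Injective fun s : S => (((s : ℝ) ^ 2 : ℝ) : ℂ) := by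
    intro a b hab
    have h1 : (a : ℝ) ^ 2 = (b : ℝ) ^ 2 := Complex.ofReal_injective hab
    exact Subtype.ext ((pow_left_inj₀ (hS a a.2).le (hS b b.2).le two_ne_zero).mp h1)
  exact h.comp hinj

theorem norm_sq_apply_sum (T : H →L[ℂ] H) (S : Finset ℝ) (hS : ∀ s ∈ S, 0 < s)
    (v : ∀ s : S, singularSpace T s) :
    ‖T (∑ s, (v s : H))‖ ^ 2 = ∑ s : S, (s : ℝ) ^ 2 * ‖v s‖ ^ 2 := by
  have hO := singularSpace_orthogonalFamily T S hS
  have h1 : (ContinuousLinearMap.adjoint T) (T (∑ s, (v s : H)))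
      = ∑ s : S, (((((s : ℝ) ^ 2 : ℝ) : ℂ) • v s : singularSpace T s) : H) := by
    rw [← ContinuousLinearMap.comp_apply, map_sum]
    refine Finset.sum_congr rfl fun s _ => ?_
    exact Module.End.mem_eigenspace_iff.mp (v s).2
  have h2 : ((‖T (∑ s, (v s : H))‖ ^ 2 : ℝ) : ℂ)
      = inner ℂ (∑ s, (v s : H)) ((ContinuousLinearMap.adjoint T) (T (∑ s, (v s : H)))) := by
    rw [ContinuousLinearMap.adjoint_inner_right, inner_self_eq_norm_sq_to_K]
    push_cast; rfl
  rw [h1] at h2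
  have h3 := hO.inner_sum v (fun s => (((s : ℝ) ^ 2 : ℝ) : ℂ) • v s) Finset.univ
  simp only [Submodule.coe_subtypeₗᵢ, Submodule.subtype_apply] at h3
  rw [h3] at h2
  have h4 : ((‖T (∑ s, (v s : H))‖ ^ 2 : ℝ) : ℂ)
      = ((∑ s : S, (s : ℝ) ^ 2 * ‖v s‖ ^ 2 : ℝ) : ℂ) := by
    rw [h2]; push_cast
    refine Finset.sum_congr rfl fun s _ => ?_
    rw [inner_smul_right, inner_self_eq_norm_sq_to_K]
    rfl
  exact_mod_cast h4

/-- The number of singular values above `t`, with multiplicity, is at most the rank of any operator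
within distance `t`. -/
theorem sum_finrank_singularSpace_le {T A : H →L[ℂ] H} {t : ℝ} (ht : 0 ≤ t) {N : ℕ}
    (hA : (A : H →ₗ[ℂ] H).rank ≤ (N : Cardinal)) (hTA : ‖T - A‖ ≤ t)
    (S : Finset ℝ) (hS : ∀ s ∈ S, t < s) :
    ∑ s ∈ S, Module.finrank ℂ (singularSpace T s) ≤ N := by
  classical
  have hS0 : ∀ s ∈ S, 0 < s := fun s hs => lt_of_le_of_lt ht (hS s hs)
  have hO := singularSpace_orthogonalFamily T S hS0
  let Λ : (∀ s : S, singularSpace T s) →ₗ[ℂ] H :=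
    ∑ s : S, (singularSpace T s).subtype ∘ₗ LinearMap.proj s
  have hΛ : ∀ v, Λ v = ∑ s, (v s : H) := fun v => by simp [Λ, LinearMap.sum_apply]
  -- On the sum of the chosen eigenspaces ‖Tv‖ > t‖v‖ unless v = 0, whereas A v = 0 would give ‖Tv‖
  -- = ‖(T - A)v‖ ≤ t‖v‖. Hence A is injective there and its rank bounds the dimension.
  have hinj : Function.Injective ((A : H →ₗ[ℂ] H) ∘ₗ Λ) := by
    rw [← LinearMap.ker_eq_bot, LinearMap.ker_eq_bot']
    intro v hv
    have hv' : A (Λ v) = 0 := hv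
    have h1 : ‖T (Λ v)‖ ≤ t * ‖Λ v‖ := by
      have : T (Λ v) = (T - A) (Λ v) := by simp [hv']
      rw [this]
      exact (ContinuousLinearMap.le_opNorm _ _).trans (by gcongr)
    have h2 : ‖T (Λ v)‖ ^ 2 ≤ t ^ 2 * ‖Λ v‖ ^ 2 := by
      rw [← mul_pow]; gcongr
    rw [hΛ, norm_sq_apply_sum T S hS0] at h2
    have h3 := hO.norm_sum v Finset.univ
    simp only [Submodule.coe_subtypeₗᵢ, Submodule.subtype_apply] at h3
    rw [h3, Finset.mul_sum, ← sub_nonneg, ← Finset.sum_sub_distrib] at h2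
    by_contra hne
    obtain ⟨s, hs⟩ : ∃ s, v s ≠ 0 := by
      by_contra! hcon
      exact hne (funext hcon)
    have h4 : ∑ s : S, (t ^ 2 * ‖v s‖ ^ 2 - (s : ℝ) ^ 2 * ‖v s‖ ^ 2) < 0 := by
      have key : ∀ r : S, t ^ 2 < (r : ℝ) ^ 2 := fun r => by
        have := hS r r.2; gcongr
      refine Finset.sum_neg' (fun r _ => ?_) ⟨s, Finset.mem_univ _, ?_⟩
      · rw [← sub_mul]
        exact mul_nonpos_of_nonpos_of_nonneg (sub_nonpos.mpr (key r).le) (by positivity)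
      · rw [← sub_mul]
        exact mul_neg_of_neg_of_pos (sub_neg.mpr (key s)) (by positivity)
    linarith
  have hrank : Module.rank ℂ (∀ s : S, singularSpace T s) ≤ (N : Cardinal) := by
    let B : (∀ s : S, singularSpace T s) →ₗ[ℂ] LinearMap.range (A : H →ₗ[ℂ] H) :=
      (A : H →ₗ[ℂ] H).rangeRestrict ∘ₗ Λ
    have hB : Function.Injective B := fun a b hab => hinj (congrArg Subtype.val hab)
    exact (LinearMap.rank_le_of_injective B hB).trans hA
  have hfin : Module.Finite ℂ (∀ s : S, singularSpace T s) :=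
    Module.rank_lt_aleph0_iff.mp (lt_of_le_of_lt hrank (Cardinal.natCast_lt_aleph0))
  have hfin' : ∀ s : S, Module.Finite ℂ (singularSpace T s) := fun s =>
    Module.Finite.of_surjective (LinearMap.proj s : (∀ s : S, singularSpace T s) →ₗ[ℂ] _)
      (LinearMap.proj_surjective s)
  have h5 : Module.finrank ℂ (∀ s : S, singularSpace T s) ≤ N := Module.finrank_le_of_rank_le hrank
  rw [Module.finrank_pi_fintype] at h5
  rwa [← Finset.sum_coe_sort S fun s => Module.finrank ℂ (singularSpace T s)]

/-- A vector of this eigenspace satisfies ‖Tv‖ = s‖v‖, which exceeds ‖T‖‖v‖ unless v = 0. -/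
theorem singularSpace_eq_bot {T : H →L[ℂ] H} {s : ℝ} (hs : ‖T‖ < s) : singularSpace T s = ⊥ := by
  rw [Submodule.eq_bot_iff]
  intro v hv
  have h1 := norm_sq_apply_sum T {s} (by simpa using (norm_nonneg T).trans_lt hs)
    (fun r => ⟨if (r : ℝ) = s then v else 0, by
      split_ifs with h
      · rw [h]; exact hv
      · exact Submodule.zero_mem _⟩)
  simp only [Finset.univ_unique, Finset.default_singleton, Finset.sum_singleton, if_true,
    Submodule.coe_norm] at h1
  have h2 : ‖T v‖ ^ 2 ≤ (‖T‖ * ‖v‖) ^ 2 := by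
    gcongr; exact T.le_opNorm v
  rw [h1, mul_pow] at h2
  by_contra hv0
  have : 0 < ‖v‖ := norm_pos_iff.mpr hv0
  have h3 : s ^ 2 ≤ ‖T‖ ^ 2 := le_of_mul_le_mul_right h2 (by positivity)
  have h4 := pow_lt_pow_left₀ hs (norm_nonneg T) two_ne_zero
  linarith

/-- Approximation with n = 2^(j+1) shows that at most K·2^(j+1) singular values exceed C/4^(j+1).
Those between C/4^(j+1) and C/4^j therefore contribute at most 2 K C^p (2·4^(-p))^j, a geometric
series that converges precisely because p > 1/2. -/
theorem QuadraticApprox.isSchatten {T : H →L[ℂ] H} (hT : QuadraticApprox T) {p : ℝ}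
    (hp : 1 / 2 < p) : IsSchatten p T := by
  classical
  refine ⟨hT.isCompactOperator, ?_⟩
  obtain ⟨C₀, K, h₀⟩ := hT
  -- Enlarged beyond ‖T‖ so that no singular value exceeds C and the dyadic index can start at 0.
  set C : ℝ := max C₀ (‖T‖ + 1) with hC
  have hC0 : 0 < C := lt_of_lt_of_le (by positivity) (le_max_right _ _)
  have hTC : ‖T‖ < C := lt_of_lt_of_le (by linarith) (le_max_right _ _)
  let d : ℝ → ℝ := fun s => (Module.finrank ℂ (singularSpace T s) : ℝ)
  have hd0 : ∀ s, 0 ≤ d s := fun s => Nat.cast_nonneg _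
  have hdC : ∀ s, C < s → d s = 0 := fun s hs => by
    have : singularSpace T s = ⊥ := singularSpace_eq_bot (hTC.trans hs)
    have h0 : ∀ W : Submodule ℂ H, W = ⊥ → Module.finrank ℂ W = 0 := by
      rintro _ rfl
      exact finrank_bot ℂ H
    exact Nat.cast_eq_zero.mpr (h0 _ this)
  have hN : ∀ (S : Finset ℝ) (j : ℕ), (∀ s ∈ S, C / 4 ^ (j + 1) < s) →
      ∑ s ∈ S, d s ≤ K * 2 ^ (j + 1) := by
    intro S j hS
    obtain ⟨A, hr, hn⟩ := h₀ (2 ^ (j + 1)) Nat.one_le_two_pow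
    have h4 : (((2 ^ (j + 1) : ℕ) : ℝ)) ^ 2 = 4 ^ (j + 1) := by
      push_cast; rw [← pow_mul, mul_comm, pow_mul]; norm_num
    have h1 := sum_finrank_singularSpace_le (T := T) (t := C / 4 ^ (j + 1)) (by positivity) hr
      (hn.trans (by rw [h4]; gcongr; exact le_max_left _ _)) S hS
    have h2 : ((∑ s ∈ S, Module.finrank ℂ (singularSpace T s) : ℕ) : ℝ)
      ≤ ((K * 2 ^ (j + 1) : ℕ) : ℝ) := by exact_mod_cast h1
    push_cast at h2
    exact h2
  set q : ℝ := 2 * (4 : ℝ) ^ (-p) with hq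
  have hq0 : 0 ≤ q := by positivity
  have hq1 : q < 1 := by
    have : (4 : ℝ) ^ (-p) < (4 : ℝ) ^ (-(1 / 2 : ℝ)) :=
      Real.rpow_lt_rpow_of_exponent_lt (by norm_num) (by linarith)
    have h2 : (4 : ℝ) ^ (-(1 / 2 : ℝ)) = 1 / 2 := by
      rw [show (4 : ℝ) = 2 ^ (2 : ℝ) by norm_num, ← Real.rpow_mul (by norm_num)]
      norm_num [Real.rpow_neg_one]
    linarith
  have hsum : Summable fun j : ℕ => C ^ p * K * 2 * q ^ j :=
    (summable_geometric_of_lt_one hq0 hq1).mul_left _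
  have hpos : ∀ j : ℕ, 0 ≤ C ^ p * K * 2 * q ^ j := fun j => by positivity
  refine summable_of_sum_le (c := ∑' j : ℕ, C ^ p * K * 2 * q ^ j) ?_ ?_
  · rintro ⟨s, hs⟩
    exact mul_nonneg (Nat.cast_nonneg _) (Real.rpow_nonneg (le_of_lt hs) _)
  intro u
  -- the dyadic index of a singular value
  have hidx : ∀ s : ℝ, 0 < s → s ≤ C → ∃ j : ℕ, C / 4 ^ (j + 1) < s ∧ s ≤ C / 4 ^ j := by
    intro s hs hsC
    obtain ⟨j, h1, h2⟩ := exists_nat_pow_near (x := C / s) (y := 4) ((one_le_div hs).mpr hsC)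
      (by norm_num)
    refine ⟨j, ?_, ?_⟩
    · rw [div_lt_iff₀ (by positivity)]
      rwa [div_lt_iff₀ hs, mul_comm] at h2
    · rw [le_div_iff₀ (by positivity)]
      rwa [le_div_iff₀ hs, mul_comm] at h1
  choose! J hJ1 hJ2 using hidx
  let S : Finset ℝ := (u.map (Function.Embedding.subtype _)).filter fun s => s ≤ C
  have hSpos : ∀ s ∈ S, 0 < s := by
    intro s hs
    simp only [S, Finset.mem_filter, Finset.mem_map] at hs
    obtain ⟨⟨r, -, rfl⟩, -⟩ := hs
    exact r.2
  have hSC : ∀ s ∈ S, s ≤ C := fun s hs => (Finset.mem_filter.mp hs).2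
  -- The terms with s > C vanish, and only for s ≤ C is the dyadic index `J s` meaningful.
  have hstep : ∑ s ∈ u, d s * (s : ℝ) ^ p = ∑ s ∈ S, d s * s ^ p := by
    have e1 : ∑ s ∈ u, d s * (s : ℝ) ^ p
        = ∑ s ∈ u.map (Function.Embedding.subtype _), d s * s ^ p := by
      rw [Finset.sum_map]; rfl
    rw [e1]
    symm
    refine Finset.sum_filter_of_ne fun s _ hne => ?_
    by_contra hlt
    exact hne (by rw [hdC s (not_le.mp hlt), zero_mul])
  change ∑ s ∈ u, d s * (s : ℝ) ^ p ≤ _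
  rw [hstep]
  have hfib : ∑ s ∈ S, d s * s ^ p = ∑ j ∈ S.image J, ∑ s ∈ S.filter fun s => J s = j, d s * s ^ p :=
    (Finset.sum_fiberwise_of_maps_to (fun s hs => Finset.mem_image_of_mem J hs) _).symm
  rw [hfib]
  refine le_trans (Finset.sum_le_sum fun j _ => ?_)
    (hsum.sum_le_tsum (S.image J) fun j _ => hpos j)
  have hb : ∀ s ∈ S.filter fun s => J s = j, d s * s ^ p ≤ d s * (C / 4 ^ j) ^ p := by
    intro s hs
    obtain ⟨hs, hj⟩ := Finset.mem_filter.mp hs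
    have := hJ2 s (hSpos s hs) (hSC s hs)
    rw [hj] at this
    exact mul_le_mul_of_nonneg_left
      (Real.rpow_le_rpow (hSpos s hs).le this (by linarith)) (hd0 s)
  refine (Finset.sum_le_sum hb).trans ?_
  rw [← Finset.sum_mul]
  have h1 := hN (S.filter fun s => J s = j) j (by
    intro s hs
    obtain ⟨hs, hj⟩ := Finset.mem_filter.mp hs
    have := hJ1 s (hSpos s hs) (hSC s hs)
    rwa [hj] at this)
  refine (mul_le_mul_of_nonneg_right h1 (by positivity)).trans (le_of_eq ?_)
  rw [Real.div_rpow hC0.le (by positivity), hq, mul_pow, ← Real.rpow_natCast ((4 : ℝ) ^ (-p)),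
    ← Real.rpow_mul (by norm_num), ← Real.rpow_natCast (4 : ℝ) j, ← Real.rpow_mul (by norm_num),
    div_eq_mul_inv, ← Real.rpow_neg (by norm_num), pow_succ]
  rw [show -((j : ℝ) * p) = -p * j by ring]
  ring

end Schatten

/-! ### Integral operators on L² of a finite measure -/

section KernelOperators

variable {α : Type*} [MeasurableSpace α] {μ : Measure α}

theorem L2_norm_sq (F : Lp ℂ 2 μ) : ‖F‖ ^ 2 = ∫ x, ‖F x‖ ^ 2 ∂μ := by
  have h : ((‖F‖ ^ 2 : ℝ) : ℂ) = ((∫ x, ‖F x‖ ^ 2 ∂μ : ℝ) : ℂ) := by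
    have h1 := inner_self_eq_norm_sq_to_K (𝕜 := ℂ) F
    rw [L2.inner_def] at h1
    have h2 : ∀ x, inner ℂ (F x) (F x) = ((‖F x‖ ^ 2 : ℝ) : ℂ) := fun x => by
      rw [inner_self_eq_norm_sq_to_K]; push_cast; rfl
    simp only [h2] at h1
    rw [integral_complex_ofReal] at h1
    rw [h1]; push_cast; rfl
  exact_mod_cast h

theorem L2_integrable_norm_sq (F : Lp ℂ 2 μ) : Integrable (fun x => ‖F x‖ ^ 2) μ :=
  (memLp_two_iff_integrable_sq_norm (Lp.memLp F).1).mp (Lp.memLp F)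

theorem L2_integrable [IsFiniteMeasure μ] (F : Lp ℂ 2 μ) : Integrable F μ :=
  (Lp.memLp F).integrable one_le_two

/-- Cauchy–Schwarz against 1, read off from ∫ (V‖F‖ - I)² ≥ 0 with V the total mass and I = ∫‖F‖.
Expanding gives V(VQ - I²) ≥ 0, so the case V = 0 is treated apart. -/
theorem sq_integral_norm_le [IsFiniteMeasure μ] {F : α → ℂ} (h1 : Integrable F μ)
    (h2 : Integrable (fun x => ‖F x‖ ^ 2) μ) :
    (∫ x, ‖F x‖ ∂μ) ^ 2 ≤ μ.real univ * ∫ x, ‖F x‖ ^ 2 ∂μ := by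
  set I := ∫ x, ‖F x‖ ∂μ with hI
  set V := μ.real univ with hV
  set Q := ∫ x, ‖F x‖ ^ 2 ∂μ with hQ
  have key : 0 ≤ V ^ 2 * Q - 2 * V * I * I + I ^ 2 * V := by
    have h3 : 0 ≤ ∫ x, (V * ‖F x‖ - I) ^ 2 ∂μ := integral_nonneg fun x => sq_nonneg _
    have h4 : ∫ x, (V * ‖F x‖ - I) ^ 2 ∂μ
        = ∫ x, (V ^ 2 * ‖F x‖ ^ 2 - 2 * V * I * ‖F x‖ + I ^ 2) ∂μ :=
      integral_congr_ae (Eventually.of_forall fun x => by simp only; ring)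
    have i1 : Integrable (fun x => V ^ 2 * ‖F x‖ ^ 2) μ := h2.const_mul _
    have i2 : Integrable (fun x => 2 * V * I * ‖F x‖) μ := h1.norm.const_mul _
    have i3 : Integrable (fun x => V ^ 2 * ‖F x‖ ^ 2 - 2 * V * I * ‖F x‖) μ := i1.sub i2
    rw [h4, integral_add i3 (integrable_const _), integral_sub i1 i2, integral_const_mul,
      integral_const_mul, integral_const] at h3
    simp only [smul_eq_mul, ← hI, ← hV, ← hQ] at h3
    linarith
  rcases (measureReal_nonneg : 0 ≤ V).eq_or_lt with h0 | h0
  · have hμ : μ = 0 := by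
      have : μ.real univ = 0 := h0.symm
      rwa [measureReal_eq_zero_iff, Measure.measure_univ_eq_zero] at this
    have hI0 : I = 0 := by rw [hI, hμ]; simp
    rw [hI0, hV, ← h0]; simp
  · have : 0 ≤ V * (V * Q - I ^ 2) := by linarith
    nlinarith [nonneg_of_mul_nonneg_right this h0]

/-- A function that is bounded on each cell `E j` by `M j` times the `L¹` norm of `F` on that cell
has `L²` norm at most `δ` times that of `F` if `M j * μ (E j) ≤ δ`. -/
theorem L2_norm_le_of_cells [IsFiniteMeasure μ] {ι : Type*} [Fintype ι] {E : ι → Set α}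
    (hE : ∀ j, MeasurableSet (E j)) (hdisj : Pairwise (Function.onFun Disjoint E))
    (hcov : ∀ᵐ x ∂μ, ∃ j, x ∈ E j) {M : ι → ℝ} (hM : ∀ j, 0 ≤ M j) {δ : ℝ} (hδ : 0 ≤ δ)
    (hMδ : ∀ j, M j * μ.real (E j) ≤ δ) (F U : Lp ℂ 2 μ)
    (hU : ∀ᵐ x ∂μ, ∀ j, x ∈ E j → ‖U x‖ ≤ M j * ∫ y in E j, ‖F y‖ ∂μ) : ‖U‖ ≤ δ * ‖F‖ := by
  have hsplit : ∀ W : Lp ℂ 2 μ, ‖W‖ ^ 2 = ∑ j, ∫ x in E j, ‖W x‖ ^ 2 ∂μ := fun W => by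
    rw [L2_norm_sq, ← integral_iUnion_fintype hE hdisj
      (fun j => (L2_integrable_norm_sq W).integrableOn)]
    rw [Measure.restrict_eq_self_of_ae_mem]
    filter_upwards [hcov] with x hx
    exact mem_iUnion.mpr hx
  refine le_of_sq_le_sq ?_ (by positivity)
  rw [mul_pow, hsplit U, hsplit F, Finset.mul_sum]
  refine Finset.sum_le_sum fun j _ => ?_
  set I := ∫ y in E j, ‖F y‖ ∂μ with hI
  have hI0 : 0 ≤ I := integral_nonneg fun _ => norm_nonneg _
  have h1 : ∫ x in E j, ‖U x‖ ^ 2 ∂μ ≤ ∫ x in E j, (M j * I) ^ 2 ∂μ := by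
    refine integral_mono_ae (L2_integrable_norm_sq U).integrableOn (integrable_const _) ?_
    filter_upwards [ae_restrict_of_ae hU, ae_restrict_mem (hE j)] with x hx hxj
    have := hx j hxj
    gcongr
  have h2 : I ^ 2 ≤ μ.real (E j) * ∫ x in E j, ‖F x‖ ^ 2 ∂μ := by
    have := sq_integral_norm_le (μ := μ.restrict (E j)) (L2_integrable F).integrableOn
      (L2_integrable_norm_sq F).integrableOn
    simpa [measureReal_restrict_apply] using this
  have hQ : 0 ≤ ∫ x in E j, ‖F x‖ ^ 2 ∂μ := integral_nonneg fun _ => by positivity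
  calc ∫ x in E j, ‖U x‖ ^ 2 ∂μ ≤ μ.real (E j) * (M j * I) ^ 2 := by
        refine h1.trans (le_of_eq ?_)
        simp [measureReal_restrict_apply]
    _ = μ.real (E j) * M j ^ 2 * I ^ 2 := by ring
    _ ≤ μ.real (E j) * M j ^ 2 * (μ.real (E j) * ∫ x in E j, ‖F x‖ ^ 2 ∂μ) := by gcongr
    _ = (M j * μ.real (E j)) ^ 2 * ∫ x in E j, ‖F x‖ ^ 2 ∂μ := by ring
    _ ≤ δ ^ 2 * ∫ x in E j, ‖F x‖ ^ 2 ∂μ := by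
        have := hMδ j
        have h0 : 0 ≤ M j * μ.real (E j) := mul_nonneg (hM j) measureReal_nonneg
        gcongr

/-- The finite rank operator `F ↦ ∑ i, (∫ c i * F) • a i`. -/
theorem exists_finite_rank_operator {ι : Type*} [Fintype ι] {a c : ι → α → ℂ}
    (ha : ∀ i, MemLp (a i) 2 μ) (hc : ∀ i, MemLp (c i) 2 μ) :
    ∃ A : Lp ℂ 2 μ →L[ℂ] Lp ℂ 2 μ,
      (A : Lp ℂ 2 μ →ₗ[ℂ] Lp ℂ 2 μ).rank ≤ ((Fintype.card ι : ℕ) : Cardinal) ∧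
      ∀ F : Lp ℂ 2 μ, ∀ᵐ x ∂μ, A F x = ∑ i, a i x * ∫ y, c i y * F y ∂μ := by
  classical
  -- The inner product is conjugate linear in its first argument, hence the conjugate of `c i`.
  let φ : ι → (Lp ℂ 2 μ →L[ℂ] ℂ) := fun i => innerSL ℂ ((hc i).star.toLp _)
  have hφ : ∀ i F, φ i F = ∫ y, c i y * F y ∂μ := fun i F => by
    change inner ℂ ((hc i).star.toLp _) F = _
    rw [L2.inner_def]
    refine integral_congr_ae ?_
    filter_upwards [(hc i).star.coeFn_toLp] with y hy
    rw [hy]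
    simp [mul_comm]
  let B : ι → (Lp ℂ 2 μ →L[ℂ] Lp ℂ 2 μ) := fun i => (φ i).smulRight ((ha i).toLp _)
  have hBr : ∀ i, (B i : Lp ℂ 2 μ →ₗ[ℂ] Lp ℂ 2 μ).rank ≤ 1 := fun i => by
    refine (Submodule.rank_mono (t := Submodule.span ℂ {(ha i).toLp _}) ?_).trans
      (rank_span_le _ |>.trans (by simp))
    rintro _ ⟨F, rfl⟩
    exact Submodule.smul_mem _ _ (Submodule.mem_span_singleton_self _)
  refine ⟨∑ i, B i, ?_, fun F => ?_⟩
  · rw [ContinuousLinearMap.toLinearMap_sum]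
    refine (LinearMap.rank_finsetSum_le _ _).trans ((Finset.sum_le_sum fun i _ => hBr i).trans ?_)
    simp
  · have h1 : ∀ᵐ x ∂μ, ∀ i, (B i F : α → ℂ) x = a i x * ∫ y, c i y * F y ∂μ := by
      rw [ae_all_iff]
      intro i
      have : B i F = (∫ y, c i y * F y ∂μ) • (ha i).toLp _ := by
        rw [← hφ]; rfl
      rw [this]
      filter_upwards [Lp.coeFn_smul (∫ y, c i y * F y ∂μ) ((ha i).toLp _), (ha i).coeFn_toLp]
        with x h1 h2
      rw [h1, Pi.smul_apply, h2, smul_eq_mul, mul_comm]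
    filter_upwards [h1, Lp.coeFn_finsetSum Finset.univ fun i => B i F] with x h1 h2
    rw [sum_apply, h2, Finset.sum_apply]
    exact Finset.sum_congr rfl fun i _ => h1 i

variable [IsFiniteMeasure μ]

theorem kernel_integrable {G : α → α → ℂ} (hG : Measurable (Function.uncurry G)) {M : ℝ}
    (hM : ∀ x y, ‖G x y‖ ≤ M) (F : Lp ℂ 2 μ) (x : α) : Integrable (fun y => G x y * F y) μ :=
  (L2_integrable F).bdd_mul (hG.of_uncurry_left).aestronglyMeasurable
    (Eventually.of_forall fun y => hM x y)

theorem norm_kernel_integral_le {G : α → α → ℂ} {M : ℝ} (hM : ∀ x y, ‖G x y‖ ≤ M)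
    (F : Lp ℂ 2 μ) (x : α) : ‖∫ y, G x y * F y ∂μ‖ ≤ M * ∫ y, ‖F y‖ ∂μ := by
  rw [← integral_const_mul]
  refine norm_integral_le_of_norm_le ((L2_integrable F).norm.const_mul _)
    (Eventually.of_forall fun y => ?_)
  rw [norm_mul]
  exact mul_le_mul_of_nonneg_right (hM x y) (norm_nonneg _)

theorem kernel_memLp {G : α → α → ℂ} (hG : Measurable (Function.uncurry G)) {M : ℝ}
    (hM : ∀ x y, ‖G x y‖ ≤ M) (F : Lp ℂ 2 μ) : MemLp (fun x => ∫ y, G x y * F y ∂μ) 2 μ := by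
  refine MemLp.of_bound (C := M * ∫ y, ‖F y‖ ∂μ) ?_
    (Eventually.of_forall fun x => norm_kernel_integral_le hM F x)
  refine StronglyMeasurable.aestronglyMeasurable ?_
  refine StronglyMeasurable.integral_prod_right (f := fun x y => G x y * F y) ?_
  exact hG.stronglyMeasurable.mul ((Lp.stronglyMeasurable F).comp_measurable measurable_snd)

/-- A bounded measurable kernel defines a bounded operator on `L²` of a finite measure. -/
theorem exists_kernel_operator {G : α → α → ℂ} (hG : Measurable (Function.uncurry G)) {M : ℝ}
    (hM : ∀ x y, ‖G x y‖ ≤ M) : ∃ T : Lp ℂ 2 μ →L[ℂ] Lp ℂ 2 μ, ∀ F : Lp ℂ 2 μ, ∀ᵐ x ∂μ,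
      Integrable (fun y => G x y * F y) μ ∧ T F x = ∫ y, G x y * F y ∂μ := by
  let T₀ : Lp ℂ 2 μ →ₗ[ℂ] Lp ℂ 2 μ :=
    { toFun := fun F => (kernel_memLp hG hM F).toLp _
      map_add' := fun F F' => by
        refine Lp.ext ?_
        filter_upwards [(kernel_memLp hG hM (F + F')).coeFn_toLp,
          (kernel_memLp hG hM F).coeFn_toLp, (kernel_memLp hG hM F').coeFn_toLp,
          Lp.coeFn_add ((kernel_memLp hG hM F).toLp _) ((kernel_memLp hG hM F').toLp _)]
          with x h1 h2 h3 h4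
        rw [h1, h4, Pi.add_apply, h2, h3, ← integral_add (kernel_integrable hG hM F x)
          (kernel_integrable hG hM F' x)]
        refine integral_congr_ae ?_
        filter_upwards [Lp.coeFn_add F F'] with y hy
        rw [hy, Pi.add_apply, mul_add]
      map_smul' := fun c F => by
        refine Lp.ext ?_
        filter_upwards [(kernel_memLp hG hM (c • F)).coeFn_toLp,
          (kernel_memLp hG hM F).coeFn_toLp,
          Lp.coeFn_smul c ((kernel_memLp hG hM F).toLp _)] with x h1 h2 h4
        rw [h1, RingHom.id_apply, h4, Pi.smul_apply, h2, smul_eq_mul, ← integral_const_mul]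
        refine integral_congr_ae ?_
        filter_upwards [Lp.coeFn_smul c F] with y hy
        rw [hy, Pi.smul_apply, smul_eq_mul]
        ring }
  have hT₀ : ∀ F, (T₀ F : α → ℂ) =ᵐ[μ] fun x => ∫ y, G x y * F y ∂μ := fun F =>
    (kernel_memLp hG hM F).coeFn_toLp
  -- A point of the space is what forces M ≥ 0.
  rcases isEmpty_or_nonempty α with hα | ⟨⟨x₀⟩⟩
  · exact ⟨0, fun F => Eventually.of_forall fun x => (hα.false x).elim⟩
  have hM0 : 0 ≤ M := (norm_nonneg _).trans (hM x₀ x₀)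
  refine ⟨T₀.mkContinuous (M * μ.real univ) fun F => ?_, fun F => ?_⟩
  -- The cell estimate with the whole space as the only cell.
  · refine L2_norm_le_of_cells (ι := Unit) (E := fun _ => univ) (M := fun _ => M)
      (fun _ => MeasurableSet.univ) (fun i j hij => (hij rfl).elim)
      (Eventually.of_forall fun x => ⟨(), mem_univ _⟩) (fun _ => hM0)
      (mul_nonneg hM0 measureReal_nonneg) (fun _ => le_rfl) F (T₀ F) ?_
    filter_upwards [hT₀ F] with x hx j _
    rw [hx, Measure.restrict_univ]
    exact norm_kernel_integral_le hM F x
  · filter_upwards [hT₀ F] with x hx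
    exact ⟨kernel_integrable hG hM F x, hx⟩

/-- If off the diagonal cells `E j × E j` the kernel is separable on each row `E j`, then the
integral operator is approximated by an operator of finite rank, with an error governed by the
size of the kernel on the diagonal cells. -/
theorem exists_rank_le_norm_sub_le {G : α → α → ℂ} {T : Lp ℂ 2 μ →L[ℂ] Lp ℂ 2 μ}
    (hT : ∀ F : Lp ℂ 2 μ, ∀ᵐ x ∂μ,
      Integrable (fun y => G x y * F y) μ ∧ T F x = ∫ y, G x y * F y ∂μ)
    {ι κ : Type*} [Fintype ι] [Fintype κ] {E : ι → Set α}
    (hE : ∀ j, MeasurableSet (E j)) (hdisj : Pairwise (Function.onFun Disjoint E))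
    (hcov : ∀ᵐ x ∂μ, ∃ j, x ∈ E j) {M : ι → ℝ} (hM : ∀ j, 0 ≤ M j) {δ : ℝ} (hδ : 0 ≤ δ)
    (hMδ : ∀ j, M j * μ.real (E j) ≤ δ)
    (hdiag : ∀ j, ∀ x ∈ E j, ∀ y ∈ E j, ‖G x y‖ ≤ M j) {a c : ι → κ → α → ℂ}
    (ha : ∀ j k, MemLp (a j k) 2 μ) (hc : ∀ j k, MemLp (c j k) 2 μ)
    (hoff : ∀ j, ∀ x ∈ E j, ∀ᵐ y ∂μ, y ∉ E j → G x y = ∑ k, a j k x * c j k y) :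
    ∃ A : Lp ℂ 2 μ →L[ℂ] Lp ℂ 2 μ,
      (A : Lp ℂ 2 μ →ₗ[ℂ] Lp ℂ 2 μ).rank ≤ ((Fintype.card (ι × κ) : ℕ) : Cardinal) ∧
      ‖T - A‖ ≤ δ := by
  classical
  -- Cutting the row functions to `E j` and the column functions to its complement gives A the
  -- kernel G off the diagonal blocks and 0 on them, so that T - A is block diagonal.
  obtain ⟨A, hAr, hA⟩ := exists_finite_rank_operator (μ := μ) (ι := ι × κ)
    (a := fun i => (E i.1).indicator (a i.1 i.2)) (c := fun i => (E i.1)ᶜ.indicator (c i.1 i.2))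
    (fun i => (ha _ _).indicator (hE _)) (fun i => (hc _ _).indicator (hE _).compl)
  refine ⟨A, hAr, ContinuousLinearMap.opNorm_le_bound _ hδ fun F => ?_⟩
  refine L2_norm_le_of_cells hE hdisj hcov hM hδ hMδ F _ ?_
  filter_upwards [hT F, hA F, Lp.coeFn_sub (T F) (A F)] with x ⟨hint, hTx⟩ hAx hsub j hxj
  have hx_ne : ∀ i, i ≠ j → x ∉ E i := fun i hij hxi =>
    (Set.disjoint_left.mp (hdisj hij) hxi) hxj
  have hA' : A F x = ∑ k, a j k x * ∫ y, (E j)ᶜ.indicator (c j k) y * F y ∂μ := by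
    rw [hAx, Fintype.sum_prod_type, Finset.sum_eq_single j]
    · simp [indicator_of_mem hxj]
    · intro i _ hij
      simp [indicator_of_notMem (hx_ne i hij)]
    · simp
  have hci : ∀ k, Integrable (fun y => (E j)ᶜ.indicator (c j k) y * F y) μ := fun k =>
    ((hc j k).indicator (hE j).compl).integrable_mul (Lp.memLp F)
  have hA'' : A F x = ∫ y, (E j)ᶜ.indicator (fun y => G x y * F y) y ∂μ := by
    rw [hA']
    simp_rw [← integral_const_mul]
    rw [← integral_finsetSum _ fun k _ => (hci k).const_mul _]
    refine integral_congr_ae ?_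
    filter_upwards [hoff j x hxj] with y hy
    by_cases hyj : y ∈ E j
    · simp [hyj]
    · rw [indicator_of_mem (show y ∈ (E j)ᶜ from hyj), hy hyj, Finset.sum_mul]
      refine Finset.sum_congr rfl fun k _ => ?_
      rw [indicator_of_mem (show y ∈ (E j)ᶜ from hyj)]
      ring
  rw [sub_apply, hsub, Pi.sub_apply, hTx, hA'',
    ← integral_sub hint (hint.indicator (hE j).compl)]
  have h3 : ∫ y, (G x y * F y - (E j)ᶜ.indicator (fun y => G x y * F y) y) ∂μ
      = ∫ y in E j, G x y * F y ∂μ := by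
    rw [← integral_indicator (hE j)]
    refine integral_congr_ae (Eventually.of_forall fun y => ?_)
    by_cases hyj : y ∈ E j <;> simp [hyj]
  rw [h3, ← integral_const_mul]
  refine norm_integral_le_of_norm_le ((L2_integrable F).norm.const_mul _).integrableOn ?_
  filter_upwards [ae_restrict_mem (hE j)] with y hy
  rw [norm_mul]
  exact mul_le_mul_of_nonneg_right (hdiag j x hxj y hy) (norm_nonneg _)

end KernelOperators

/-! ### The phase, the weight and their behaviour at the zeros of f -/

/-- The phase `∫ 1 / (ε f)` on `(0, π)`. -/
noncomputable def phase (f : ℝ → ℝ) (ε x : ℝ) : ℝ :=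
  ∫ y in (Real.pi / 2)..x, 1 / (ε * f y)

/-- The even, positive function to which the weight is proportional on either side of `0`. -/
noncomputable def expPhase (f : ℝ → ℝ) (ε x : ℝ) : ℝ := Real.exp (phase f ε |x|)

theorem expPhase_pos (f : ℝ → ℝ) (ε x : ℝ) : 0 < expPhase f ε x := Real.exp_pos _

theorem expPhase_neg (f : ℝ → ℝ) (ε x : ℝ) : expPhase f ε (-x) = expPhase f ε x := by
  simp [expPhase]

theorem expPhase_of_pos (f : ℝ → ℝ) (ε : ℝ) {x : ℝ} (hx : 0 < x) :
    expPhase f ε x = Real.exp (phase f ε x) := by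
  rw [expPhase, abs_of_pos hx]

theorem uIcc_half_pi_subset {x : ℝ} (hx : x ∈ Ioo 0 Real.pi) :
    uIcc (Real.pi / 2) x ⊆ Ioo 0 Real.pi :=
  have hpi := Real.pi_pos
  ordConnected_Ioo.uIcc_subset ⟨by linarith, by linarith⟩ hx

namespace Coefficient

variable {f : ℝ → ℝ} (hf : Coefficient f)
include hf

theorem map_zero : f 0 = 0 := by
  have := hf.odd 0
  simp only [neg_zero] at this
  linarith

/-- This symmetry transfers every estimate near 0 to one near π. -/
theorem refl (x : ℝ) : f (Real.pi - x) = f x := by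
  rw [show Real.pi - x = -x + Real.pi by ring, hf.antiperiodic, hf.odd, neg_neg]

theorem continuous : Continuous f := by
  rw [continuous_iff_continuousAt]
  intro x
  have h := (hf.absCont (x - 1) (x + 1)).continuousOn
  rw [uIcc_of_le (by linarith)] at h
  exact h.continuousAt (Icc_mem_nhds (by linarith) (by linarith))

theorem differentiableAt_zero : DifferentiableAt ℝ f 0 := by
  simpa using hf.diff_int_mul_pi 0

theorem deriv_zero_pos : 0 < deriv f 0 := by
  refine lt_of_le_of_ne ?_ hf.deriv_zero_ne.symm
  have h := hf.differentiableAt_zero.hasDerivAt.tendsto_slope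
  have h' : Tendsto (slope f 0) (𝓝[>] 0) (𝓝 (deriv f 0)) :=
    h.mono_left (nhdsWithin_mono _ fun x hx => ne_of_gt hx)
  refine ge_of_tendsto h' ?_
  filter_upwards [Ioo_mem_nhdsGT Real.pi_pos] with x hx
  rw [slope_def_field, hf.map_zero]
  exact div_nonneg (by linarith [hf.pos x hx]) (by linarith [hx.1])

/-- The quotient f(x)/x extends continuously to 0 by f'(0) > 0, so it has a positive minimum and a
maximum on the compact interval. -/
theorem exists_linear_bounds : ∃ m M : ℝ, 0 < m ∧ 0 < M ∧
    ∀ x ∈ Ioc 0 (Real.pi / 2), m * x ≤ f x ∧ f x ≤ M * x := by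
  have hpi := Real.pi_pos
  have hcont : ContinuousOn (dslope f 0) (Icc 0 (Real.pi / 2)) :=
    ((continuousOn_dslope univ_mem).mpr
      ⟨hf.continuous.continuousOn, hf.differentiableAt_zero⟩).mono (subset_univ _)
  have hval : ∀ x, x ≠ 0 → dslope f 0 x = f x / x := fun x hx => by
    rw [dslope_of_ne _ hx, slope_def_field, hf.map_zero, sub_zero, sub_zero]
  have hpos : ∀ x ∈ Icc 0 (Real.pi / 2), 0 < dslope f 0 x := by
    intro x hx
    rcases hx.1.eq_or_lt with h | h
    · rw [← h, dslope_same]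
      exact hf.deriv_zero_pos
    · rw [hval x h.ne']
      exact div_pos (hf.pos x ⟨h, by linarith [hx.2]⟩) h
  have hne : (Icc 0 (Real.pi / 2)).Nonempty := ⟨0, by simp; positivity⟩
  obtain ⟨a, ha, hamin⟩ := isCompact_Icc.exists_isMinOn hne hcont
  obtain ⟨b, hb, hbmax⟩ := isCompact_Icc.exists_isMaxOn hne hcont
  refine ⟨dslope f 0 a, dslope f 0 b, hpos a ha, hpos b hb, fun x hx => ?_⟩
  have hx' : x ∈ Icc 0 (Real.pi / 2) := ⟨hx.1.le, hx.2⟩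
  have h1 := hamin hx'
  have h2 := hbmax hx'
  simp only [mem_ofPred_eq, hval x hx.1.ne'] at h1 h2
  exact ⟨(le_div_iff₀ hx.1).mp h1, (div_le_iff₀ hx.1).mp h2⟩

theorem continuousOn_inv (ε : ℝ) (hε : 0 < ε) :
    ContinuousOn (fun y => 1 / (ε * f y)) (Ioo 0 Real.pi) :=
  continuousOn_const.div (continuousOn_const.mul hf.continuous.continuousOn) fun x hx =>
    (mul_pos hε (hf.pos x hx)).ne'

variable {ε : ℝ} (hε : 0 < ε)
include hε

theorem phase_hasDerivAt {x : ℝ} (hx : x ∈ Ioo 0 Real.pi) :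
    HasDerivAt (phase f ε) (1 / (ε * f x)) x := by
  have hc := hf.continuousOn_inv ε hε
  refine intervalIntegral.integral_hasDerivAt_right
    ((hc.mono (uIcc_half_pi_subset hx)).intervalIntegrable)
    (hc.stronglyMeasurableAtFilter isOpen_Ioo x hx) (hc.continuousAt (Ioo_mem_nhds hx.1 hx.2))

theorem phase_continuousOn : ContinuousOn (phase f ε) (Ioo 0 Real.pi) := fun _ hx =>
  (hf.phase_hasDerivAt hε hx).continuousAt.continuousWithinAt

theorem phase_monotoneOn : MonotoneOn (phase f ε) (Ioo 0 Real.pi) := by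
  refine monotoneOn_of_deriv_nonneg (convex_Ioo _ _) (hf.phase_continuousOn hε) ?_ ?_
  · rw [interior_Ioo]
    exact fun x hx => (hf.phase_hasDerivAt hε hx).differentiableAt.differentiableWithinAt
  · rw [interior_Ioo]
    intro x hx
    rw [(hf.phase_hasDerivAt hε hx).deriv]
    exact (one_div_pos.mpr (mul_pos hε (hf.pos x hx))).le

theorem phase_sub_le {a b η : ℝ} (hab : Icc a b ⊆ Ioo 0 Real.pi) (hle : a ≤ b) (hη : 0 < η)
    (hbd : ∀ x ∈ Ioo a b, η ≤ f x) : phase f ε b - phase f ε a ≤ (b - a) / (ε * η) := by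
  have h := (convex_Icc a b).image_sub_le_mul_sub_of_deriv_le (f := phase f ε) (C := 1 / (ε * η))
    ((hf.phase_continuousOn hε).mono hab)
    (fun x hx => by
      rw [interior_Icc] at hx
      exact (hf.phase_hasDerivAt hε (hab (Ioo_subset_Icc_self hx))).differentiableAt.differentiableWithinAt)
    (fun x hx => by
      rw [interior_Icc] at hx
      rw [(hf.phase_hasDerivAt hε (hab (Ioo_subset_Icc_self hx))).deriv]
      have := hbd x hx
      gcongr)
    a (left_mem_Icc.mpr hle) b (right_mem_Icc.mpr hle) hle
  rwa [one_div_mul_eq_div] at h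

/-- The upper bound f ≤ M x makes the phase minus log x/(ε M) increasing near 0, so the phase lies
below a constant plus log x/(ε M). Hence ω tends to 0. -/
theorem tendsto_phase_zero : Tendsto (phase f ε) (𝓝[>] 0) atBot := by
  obtain ⟨m, M, hm, hM, hb⟩ := hf.exists_linear_bounds
  have hpi := Real.pi_pos
  have hmem : Real.pi / 2 ∈ Ioo 0 Real.pi := ⟨by linarith, by linarith⟩
  have hder : ∀ x ∈ Ioo 0 Real.pi, HasDerivAt (fun x => phase f ε x - Real.log x / (ε * M))
      (1 / (ε * f x) - x⁻¹ / (ε * M)) x := fun x hx =>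
    (hf.phase_hasDerivAt hε hx).sub ((Real.hasDerivAt_log hx.1.ne').div_const _)
  have hmono : MonotoneOn (fun x => phase f ε x - Real.log x / (ε * M)) (Ioc 0 (Real.pi / 2)) := by
    have hsub : Ioc 0 (Real.pi / 2) ⊆ Ioo 0 Real.pi := fun x hx => ⟨hx.1, by linarith [hx.2]⟩
    refine monotoneOn_of_deriv_nonneg (convex_Ioc _ _)
      (fun x hx => (hder x (hsub hx)).continuousAt.continuousWithinAt) ?_ ?_
    · exact fun x hx =>
        (hder x (hsub (interior_subset hx))).differentiableAt.differentiableWithinAt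
    · intro x hx
      have hx := interior_subset hx
      rw [(hder x (hsub hx)).deriv, sub_nonneg, inv_eq_one_div, div_div]
      have h1 := hf.pos x (hsub hx)
      have h2 := (hb x hx).2
      refine one_div_le_one_div_of_le (mul_pos hε h1) ?_
      nlinarith
  have hlog : Tendsto (fun x => Real.log x / (ε * M)
      + (phase f ε (Real.pi / 2) - Real.log (Real.pi / 2) / (ε * M))) (𝓝[>] 0) atBot :=
    tendsto_atBot_add_const_right _ _
      ((Real.tendsto_log_nhdsGT_zero).atBot_div_const (mul_pos hε hM))
  refine tendsto_atBot_mono' _ ?_ hlog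
  filter_upwards [Ioo_mem_nhdsGT (show (0 : ℝ) < Real.pi / 2 by positivity)] with x hx
  have := hmono ⟨hx.1, hx.2.le⟩ ⟨by positivity, le_rfl⟩ hx.2.le
  simp only at this
  linarith

omit hε in
theorem phase_refl (x : ℝ) : phase f ε (Real.pi - x) = -phase f ε x := by
  have h := intervalIntegral.integral_comp_sub_left (a := x) (b := Real.pi / 2)
    (fun y => 1 / (ε * f y)) Real.pi
  simp only [hf.refl] at h
  rw [show Real.pi - Real.pi / 2 = Real.pi / 2 by ring] at h
  rw [phase, ← h, intervalIntegral.integral_symm, phase]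

theorem tendsto_phase_pi : Tendsto (phase f ε) (𝓝[<] Real.pi) atTop := by
  have h1 : Tendsto (fun x => Real.pi - x) (𝓝[<] Real.pi) (𝓝[>] 0) := by
    refine tendsto_nhdsWithin_iff.mpr ⟨?_, ?_⟩
    · have : Tendsto (fun x => Real.pi - x) (𝓝 Real.pi) (𝓝 (Real.pi - Real.pi)) :=
        (continuous_const.sub continuous_id).tendsto _
      rw [sub_self] at this
      exact this.mono_left nhdsWithin_le_nhds
    · filter_upwards [self_mem_nhdsWithin] with x hx
      exact sub_pos.mpr (show x < Real.pi from hx)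
  have h2 := tendsto_neg_atBot_atTop.comp ((hf.tendsto_phase_zero hε).comp h1)
  refine h2.congr fun x => ?_
  simp [hf.phase_refl]

-- Absolute continuity makes f' integrable, and 1/f is bounded on a compact part of (0, π). The
-- primitive log f is differentiable off a finite set, which suffices for the fundamental theorem.
omit hε in
theorem integral_log_deriv {x : ℝ} (hx : x ∈ Ioo 0 Real.pi) :
    IntervalIntegrable (fun y => deriv f y / f y) volume (Real.pi / 2) x ∧
    ∫ y in (Real.pi / 2)..x, deriv f y / f y = Real.log (f x) - Real.log (f (Real.pi / 2)) := by
  have hsub := uIcc_half_pi_subset hx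
  have hpos : ∀ y ∈ uIcc (Real.pi / 2) x, f y ≠ 0 := fun y hy => (hf.pos y (hsub hy)).ne'
  have hint : IntervalIntegrable (fun y => deriv f y / f y) volume (Real.pi / 2) x := by
    simp only [div_eq_mul_inv]
    exact (hf.absCont _ _).intervalIntegrable_deriv.mul_continuousOn
      (hf.continuous.continuousOn.inv₀ hpos)
  refine ⟨hint, ?_⟩
  refine integral_eq_of_hasDerivAt_off_countable (fun y => Real.log (f y)) _
    hf.finite_nondiff.countable (hf.continuous.continuousOn.log hpos) ?_ hint
  rintro y ⟨hy, hyn⟩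
  have hyu : y ∈ uIcc (Real.pi / 2) x := Ioo_subset_Icc_self hy
  have hyI := hsub hyu
  have hd : DifferentiableAt ℝ f y := by
    by_contra hcon
    exact hyn ⟨⟨by linarith [hyI.1, Real.pi_pos], hyI.2⟩, hcon⟩
  exact hd.hasDerivAt.log (hpos y hyu)

theorem exp_integral {x : ℝ} (hx : x ∈ Ioo 0 Real.pi) :
    Real.exp (∫ y in (Real.pi / 2)..x, (deriv f y / f y + 1 / (ε * f y)))
      = f x / f (Real.pi / 2) * expPhase f ε x := by
  obtain ⟨h1, h2⟩ := hf.integral_log_deriv hx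
  have hpi := Real.pi_pos
  have hmem : Real.pi / 2 ∈ Ioo 0 Real.pi := ⟨by linarith, by linarith⟩
  rw [intervalIntegral.integral_add h1
    ((hf.continuousOn_inv ε hε).mono (uIcc_half_pi_subset hx)).intervalIntegrable, h2,
    Real.exp_add, Real.exp_sub, Real.exp_log (hf.pos x hx), Real.exp_log (hf.pos _ hmem),
    expPhase_of_pos f ε hx.1]
  rfl

omit hε in
theorem deriv_neg (y : ℝ) : deriv f (-y) = deriv f y := by
  have h := deriv_comp_neg f y
  have h2 : (fun x => f (-x)) = fun x => -f x := funext hf.odd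
  rw [h2, deriv.fun_neg] at h
  linarith

omit hε in
theorem integral_neg (x : ℝ) :
    ∫ y in (-(Real.pi / 2))..x, (deriv f y / f y + 1 / (ε * f y))
      = ∫ y in (Real.pi / 2)..(-x), (deriv f y / f y + 1 / (ε * f y)) := by
  have h := intervalIntegral.integral_comp_neg (a := -x) (b := Real.pi / 2)
    (fun y => deriv f y / f y + 1 / (ε * f y))
  rw [neg_neg] at h
  rw [← h, intervalIntegral.integral_symm, ← intervalIntegral.integral_neg]
  refine intervalIntegral.integral_congr fun y _ => ?_
  simp only [hf.deriv_neg, hf.odd]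
  rw [mul_neg, div_neg, div_neg]
  ring

/-- The exponential of ∫ f'/f contributes f(x)/f(π/2), which cancels the f in p/f. On the negative
side everything reflects to the positive side, and oddness of f turns `cm` into `-cm`. -/
theorem weight_eq (cp cm : ℂ) {x : ℝ} (hx0 : x ≠ 0) (hx : |x| < Real.pi) :
    weight f ε cp cm x
      = (if 0 < x then cp else -cm) / (f (Real.pi / 2) : ℂ) * (expPhase f ε x : ℂ) := by
  unfold weight integratingFactor
  split_ifs with h
  · have hxI : x ∈ Ioo 0 Real.pi := ⟨h, lt_of_abs_lt hx⟩
    have hne : (f x : ℂ) ≠ 0 := by exact_mod_cast (hf.pos x hxI).ne'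
    rw [hf.exp_integral hε hxI]
    push_cast
    field_simp
  · have h' : x < 0 := lt_of_le_of_ne (not_lt.mp h) hx0
    have hxI : -x ∈ Ioo 0 Real.pi := ⟨by linarith, by linarith [(abs_lt.mp hx).1]⟩
    have hfx : f x = -f (-x) := by rw [hf.odd, neg_neg]
    have hne : (f (-x) : ℂ) ≠ 0 := by exact_mod_cast (hf.pos _ hxI).ne'
    rw [hf.integral_neg, hf.exp_integral hε hxI, expPhase_neg, hfx]
    push_cast
    field_simp

/-- When x and y have the same sign the constants of the weight cancel, so the kernel does not
depend on `cp` and `cm`. -/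
theorem psi_div_psi {cp cm : ℂ} (hcp : cp ≠ 0) (hcm : cm ≠ 0) {x y : ℝ} (hxy : 0 < x * y)
    (hx : |x| < Real.pi) (hy : |y| < Real.pi) :
    psi f ε cp cm x / psi f ε cp cm y = ((expPhase f ε y / expPhase f ε x : ℝ) : ℂ) := by
  have hpi := Real.pi_pos
  have hmem : Real.pi / 2 ∈ Ioo 0 Real.pi := ⟨by linarith, by linarith⟩
  have hx0 : x ≠ 0 := fun h => by simp [h] at hxy
  have hy0 : y ≠ 0 := fun h => by simp [h] at hxy
  have hs : (if 0 < x then cp else -cm) = if 0 < y then cp else -cm :=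
    if_congr (pos_iff_pos_of_mul_pos hxy) rfl rfl
  have hf0 : (f (Real.pi / 2) : ℂ) ≠ 0 := by exact_mod_cast (hf.pos _ hmem).ne'
  have ex : (expPhase f ε x : ℂ) ≠ 0 := by exact_mod_cast (expPhase_pos f ε x).ne'
  have ey : (expPhase f ε y : ℂ) ≠ 0 := by exact_mod_cast (expPhase_pos f ε y).ne'
  have hc : (if 0 < y then cp else -cm) ≠ 0 := by
    split_ifs
    exacts [hcp, neg_ne_zero.mpr hcm]
  rw [psi, psi, hf.weight_eq hε cp cm hx0 hx, hf.weight_eq hε cp cm hy0 hy, hs]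
  push_cast
  field_simp

end Coefficient

/-! ### The Green's kernel expressed through the weight -/

/-- The part of the square where the kernel is supported, in the first quadrant. -/
def upperTriangle : Set (ℝ × ℝ) := {q | 0 < q.2 ∧ q.2 < q.1 ∧ q.1 < Real.pi}

/-- The kernel on the quadrant where both variables are positive. -/
noncomputable def halfKernel (f : ℝ → ℝ) (ε : ℝ) : ℝ × ℝ → ℝ :=
  upperTriangle.indicator fun q => 1 - expPhase f ε q.2 / expPhase f ε q.1

/-- The Green's kernel in terms of `expPhase`. -/
noncomputable def phaseKernel (f : ℝ → ℝ) (ε x y : ℝ) : ℂ :=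
  ((halfKernel f ε (x, y) - halfKernel f ε (-x, -y) : ℝ) : ℂ)

theorem measurableSet_upperTriangle : MeasurableSet upperTriangle :=
  (measurableSet_lt measurable_const measurable_snd).inter
    ((measurableSet_lt measurable_snd measurable_fst).inter
      (measurableSet_lt measurable_fst measurable_const))

theorem ContinuousOn.measurable_indicator {X : Type*} [TopologicalSpace X] [MeasurableSpace X]
    [OpensMeasurableSpace X] {g : X → ℝ} {s : Set X} (hg : ContinuousOn g s)
    (hs : MeasurableSet s) : Measurable (s.indicator g) := by
  classical
  rw [← piecewise_eq_indicator]
  exact hg.measurable_piecewise continuousOn_const hs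

theorem mem_Ioo_pi_of_mem_Icc {a b x : ℝ} (ha : 0 < a) (hb : b < Real.pi) (hx : x ∈ Icc a b) :
    x ∈ Ioo 0 Real.pi := ⟨ha.trans_le hx.1, hx.2.trans_lt hb⟩

namespace Coefficient

variable {f : ℝ → ℝ} (hf : Coefficient f) {ε : ℝ} (hε : 0 < ε)
include hf hε

theorem expPhase_continuousOn : ContinuousOn (expPhase f ε) (Ioo 0 Real.pi) := by
  refine (((hf.phase_continuousOn hε).rexp)).congr fun x hx => ?_
  exact expPhase_of_pos f ε hx.1

theorem expPhase_mono {y x : ℝ} (hy : 0 < y) (hyx : y ≤ x) (hx : x < Real.pi) :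
    expPhase f ε y ≤ expPhase f ε x := by
  rw [expPhase_of_pos f ε hy, expPhase_of_pos f ε (hy.trans_le hyx)]
  exact Real.exp_le_exp.mpr
    (hf.phase_monotoneOn hε ⟨hy, hyx.trans_lt hx⟩ ⟨hy.trans_le hyx, hx⟩ hyx)

theorem expPhase_div_le_one {y x : ℝ} (hy : 0 < y) (hyx : y ≤ x) (hx : x < Real.pi) :
    expPhase f ε y / expPhase f ε x ≤ 1 :=
  (div_le_one (expPhase_pos _ _ _)).mpr (hf.expPhase_mono hε hy hyx hx)

theorem halfKernel_mem_Icc (q : ℝ × ℝ) : halfKernel f ε q ∈ Icc (0 : ℝ) 1 := by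
  by_cases h : q ∈ upperTriangle
  · rw [halfKernel, indicator_of_mem h]
    have h1 := hf.expPhase_div_le_one hε h.1 h.2.1.le h.2.2
    have h2 := div_pos (expPhase_pos f ε q.2) (expPhase_pos f ε q.1)
    exact ⟨by linarith, by linarith⟩
  · rw [halfKernel, indicator_of_notMem h]
    simp

theorem measurable_halfKernel : Measurable (halfKernel f ε) := by
  refine ContinuousOn.measurable_indicator ?_ measurableSet_upperTriangle
  have h := hf.expPhase_continuousOn hε
  refine continuousOn_const.sub (ContinuousOn.div ?_ ?_ fun q _ => (expPhase_pos _ _ _).ne')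
  · exact h.comp continuousOn_snd fun q hq => ⟨hq.1, hq.2.1.trans hq.2.2⟩
  · exact h.comp continuousOn_fst fun q hq => ⟨hq.1.trans hq.2.1, hq.2.2⟩

theorem measurable_phaseKernel : Measurable (Function.uncurry (phaseKernel f ε)) := by
  have h := hf.measurable_halfKernel hε
  refine Complex.measurable_ofReal.comp ?_
  exact (h.comp measurable_id).sub (h.comp (measurable_fst.neg.prodMk measurable_snd.neg))

theorem norm_phaseKernel_le (x y : ℝ) : ‖phaseKernel f ε x y‖ ≤ 1 := by
  have h1 := hf.halfKernel_mem_Icc hε (x, y)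
  have h2 := hf.halfKernel_mem_Icc hε (-x, -y)
  rw [phaseKernel, Complex.norm_real, Real.norm_eq_abs, abs_le]
  exact ⟨by linarith [h1.1, h2.2], by linarith [h1.2, h2.1]⟩

theorem greenKernel_eq {cp cm : ℂ} (hcp : cp ≠ 0) (hcm : cm ≠ 0) {x : ℝ}
    (hx : x ∈ Ioo (-Real.pi) Real.pi) (y : ℝ) :
    greenKernel f ε cp cm x y = phaseKernel f ε x y := by
  unfold greenKernel phaseKernel halfKernel
  by_cases h1 : 0 < y ∧ y < x
  · have hm : (x, y) ∈ upperTriangle := ⟨h1.1, h1.2, hx.2⟩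
    have hm' : (-x, -y) ∉ upperTriangle := fun h => by linarith [h.1, h1.1]
    rw [if_pos h1, indicator_of_mem hm, indicator_of_notMem hm', hf.psi_div_psi hε hcp hcm
      (mul_pos (h1.1.trans h1.2) h1.1) (abs_lt.mpr hx)
      (abs_lt.mpr ⟨by linarith [Real.pi_pos], by linarith [hx.2]⟩)]
    push_cast; ring
  · have hm : (x, y) ∉ upperTriangle := fun h => h1 ⟨h.1, h.2.1⟩
    rw [if_neg h1, indicator_of_notMem hm]
    by_cases h2 : x < y ∧ y < 0
    · have hm' : (-x, -y) ∈ upperTriangle := ⟨by linarith, by linarith, by linarith [hx.1]⟩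
      rw [if_pos h2, indicator_of_mem hm', hf.psi_div_psi hε hcp hcm
        (mul_pos_of_neg_of_neg (h2.1.trans h2.2) h2.2) (abs_lt.mpr hx)
        (abs_lt.mpr ⟨by linarith [hx.1], by linarith [Real.pi_pos]⟩), expPhase_neg, expPhase_neg]
      push_cast; ring
    · have hm' : (-x, -y) ∉ upperTriangle := fun h => h2 ⟨by linarith [h.2.1], by linarith [h.1]⟩
      rw [if_neg h2, indicator_of_notMem hm']
      simp

/-- The quotient is exp(-t) with t the increment of the phase from y to x, and 1 - exp(-t) ≤ t. The
lower bound η on f controls t. This quantifies the vanishing of the kernel on the diagonal. -/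
theorem one_sub_expPhase_div_le {a b η y x : ℝ} (hη : 0 < η) (hbd : ∀ t ∈ Ioo a b, η ≤ f t)
    (ha : 0 ≤ a) (hay : a < y) (hyx : y < x) (hxb : x ≤ b) (hx : x < Real.pi) :
    1 - expPhase f ε y / expPhase f ε x ≤ (b - a) / (ε * η) := by
  have hy0 : 0 < y := ha.trans_lt hay
  have h1 := hf.phase_sub_le hε (fun t ht => mem_Ioo_pi_of_mem_Icc hy0 hx ht) hyx.le hη
    fun t ht => hbd t ⟨hay.trans ht.1, ht.2.trans_le hxb⟩
  have h2 : (x - y) / (ε * η) ≤ (b - a) / (ε * η) :=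
    div_le_div_of_nonneg_right (by linarith) (by positivity)
  have h3 := Real.add_one_le_exp (phase f ε y - phase f ε x)
  rw [expPhase_of_pos f ε hy0, expPhase_of_pos f ε (hy0.trans hyx), ← Real.exp_sub]
  linarith

end Coefficient

/-! ### The graded mesh and the kernel on diagonal cells -/

/-- The quadratically graded partition of `[0, π / 2]`. -/
noncomputable def gradedPoint (n i : ℕ) : ℝ := Real.pi / 2 * ((i : ℝ) / n) ^ 2

/-- The partition of `[0, π]`, quadratically graded towards both ends. -/
noncomputable def meshPoint (n j : ℕ) : ℝ :=
  if j ≤ n then gradedPoint n j else Real.pi - gradedPoint n (2 * n - j)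

theorem gradedPoint_mono (n : ℕ) : Monotone (gradedPoint n) := fun i j hij => by
  have := Real.pi_pos
  unfold gradedPoint
  gcongr

theorem gradedPoint_zero (n : ℕ) : gradedPoint n 0 = 0 := by simp [gradedPoint]

theorem gradedPoint_self {n : ℕ} (hn : 1 ≤ n) : gradedPoint n n = Real.pi / 2 := by
  have : (n : ℝ) ≠ 0 := by positivity
  simp [gradedPoint, this]

theorem meshPoint_of_le {n j : ℕ} (h : j ≤ n) : meshPoint n j = gradedPoint n j := if_pos h

theorem meshPoint_of_ge {n j : ℕ} (hn : 1 ≤ n) (h : n ≤ j) :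
    meshPoint n j = Real.pi - gradedPoint n (2 * n - j) := by
  rcases h.eq_or_lt with rfl | h
  · rw [meshPoint_of_le le_rfl, show 2 * n - n = n by omega, gradedPoint_self hn]
    ring
  · exact if_neg (not_le.mpr h)

theorem meshPoint_mono {n : ℕ} (hn : 1 ≤ n) : Monotone (meshPoint n) := by
  refine monotone_nat_of_le_succ fun j => ?_
  by_cases h : j + 1 ≤ n
  · rw [meshPoint_of_le h, meshPoint_of_le (by omega)]
    exact gradedPoint_mono n (by omega)
  · rw [meshPoint_of_ge hn (by omega), meshPoint_of_ge hn (by omega)]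
    have := gradedPoint_mono n (show 2 * n - (j + 1) ≤ 2 * n - j by omega)
    linarith

theorem meshPoint_zero (n : ℕ) : meshPoint n 0 = 0 := by
  rw [meshPoint_of_le (Nat.zero_le _), gradedPoint_zero]

theorem meshPoint_two_mul {n : ℕ} (hn : 1 ≤ n) : meshPoint n (2 * n) = Real.pi := by
  rw [meshPoint_of_ge hn (by omega), Nat.sub_self, gradedPoint_zero, sub_zero]

namespace Coefficient

variable {f : ℝ → ℝ} (hf : Coefficient f) {ε : ℝ} (hε : 0 < ε)
include hf hε

/-- On a cell (a, b] with a > 0 the kernel is at most (b - a)/(ε m a), since f ≥ m x. With a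
proportional to i²/n² and b - a to (2i + 1)/n², the quantity (b - a)²/a is O(n⁻²) uniformly in i. In
the first cell f has no positive lower bound, but there the trivial bound 1 suffices because its
length is already π/(2n²). The factor 2 accounts for the mirror image of the cell under x ↦ -x; the
last clause follows from f(π - x) = f(x). -/
theorem exists_graded_cell_bound : ∃ C : ℝ, 0 ≤ C ∧ ∀ n : ℕ, 1 ≤ n → ∀ i < n, ∃ M : ℝ, 0 ≤ M ∧
    M * (2 * (gradedPoint n (i + 1) - gradedPoint n i)) ≤ C / (n : ℝ) ^ 2 ∧
    (∀ y x, gradedPoint n i < y → y < x → x ≤ gradedPoint n (i + 1) → x < Real.pi →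
      1 - expPhase f ε y / expPhase f ε x ≤ M) ∧
    (∀ y x, Real.pi - gradedPoint n (i + 1) < y → y < x → x ≤ Real.pi - gradedPoint n i →
      x < Real.pi → 1 - expPhase f ε y / expPhase f ε x ≤ M) := by
  obtain ⟨m, _, hm, -, hb⟩ := hf.exists_linear_bounds
  have hpi := Real.pi_pos
  refine ⟨max Real.pi (9 * Real.pi / (ε * m)), le_max_of_le_left hpi.le, fun n hn i hi => ?_⟩
  have hn0 : (0 : ℝ) < n := by exact_mod_cast hn
  have hhalf : gradedPoint n (i + 1) ≤ Real.pi / 2 := by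
    rw [← gradedPoint_self hn]
    exact gradedPoint_mono n (by omega)
  rcases Nat.eq_zero_or_pos i with rfl | hi0
  · refine ⟨1, zero_le_one, ?_, fun y x _ _ _ _ => ?_, fun y x _ _ _ _ => ?_⟩
    · rw [gradedPoint_zero, zero_add, gradedPoint]
      have : 1 * (2 * (Real.pi / 2 * (((1 : ℕ) : ℝ) / n) ^ 2 - 0)) = Real.pi / (n : ℝ) ^ 2 := by
        push_cast; field_simp; ring
      rw [this]
      gcongr
      exact le_max_left _ _
    all_goals linarith [div_pos (expPhase_pos f ε y) (expPhase_pos f ε x)]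
  · have hi1 : (1 : ℝ) ≤ i := by exact_mod_cast hi0
    set a := gradedPoint n i with ha
    set b := gradedPoint n (i + 1) with hbdef
    have ha0 : 0 < a := by rw [ha, gradedPoint]; positivity
    have hab : a ≤ b := gradedPoint_mono n (by omega)
    have hlow : ∀ t ∈ Ioo a b, m * a ≤ f t := fun t ht =>
      (mul_le_mul_of_nonneg_left ht.1.le hm.le).trans
        (hb t ⟨ha0.trans ht.1, ht.2.le.trans hhalf⟩).1
    refine ⟨(b - a) / (ε * (m * a)), div_nonneg (by linarith) (by positivity), ?_,
      fun y x hy hyx hxb hx => hf.one_sub_expPhase_div_le hε (by positivity) hlow ha0.le hy hyx hxb hx,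
      fun y x hy hyx hxb hx => ?_⟩
    · have e : (b - a) / (ε * (m * a)) * (2 * (b - a))
          = Real.pi / (ε * m) * ((2 * i + 1) / i) ^ 2 / (n : ℝ) ^ 2 := by
        rw [ha, hbdef, gradedPoint, gradedPoint]
        push_cast
        field_simp
        ring
      rw [e]
      -- Here i ≥ 1; squaring is the source of the 9 in the constant.
      have h3 : ((2 * i + 1) / i : ℝ) ≤ 3 := by
        rw [div_le_iff₀ (by linarith)]; linarith
      have h9 : ((2 * i + 1) / i : ℝ) ^ 2 ≤ 9 := by
        have : (0 : ℝ) ≤ (2 * i + 1) / i := by positivity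
        nlinarith
      gcongr
      calc Real.pi / (ε * m) * ((2 * i + 1) / i : ℝ) ^ 2 ≤ Real.pi / (ε * m) * 9 := by gcongr
        _ = 9 * Real.pi / (ε * m) := by ring
        _ ≤ _ := le_max_right _ _
    · have h := hf.one_sub_expPhase_div_le hε (η := m * a) (a := Real.pi - b) (b := Real.pi - a)
        (by positivity) (fun t ht => by
          rw [← hf.refl]
          exact hlow _ ⟨by linarith [ht.2], by linarith [ht.1]⟩) (by linarith) hy hyx hxb hx
      rwa [show Real.pi - a - (Real.pi - b) = b - a by ring] at h

theorem exists_mesh_cell_bound : ∃ C : ℝ, 0 ≤ C ∧ ∀ n : ℕ, 1 ≤ n → ∀ j < 2 * n, ∃ M : ℝ, 0 ≤ M ∧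
    M * (2 * (meshPoint n (j + 1) - meshPoint n j)) ≤ C / (n : ℝ) ^ 2 ∧
    ∀ y x, meshPoint n j < y → y < x → x ≤ meshPoint n (j + 1) → x < Real.pi →
      1 - expPhase f ε y / expPhase f ε x ≤ M := by
  obtain ⟨C, hC, h⟩ := hf.exists_graded_cell_bound hε
  refine ⟨C, hC, fun n hn j hj => ?_⟩
  by_cases hjn : j < n
  · obtain ⟨M, hM, h1, h2, -⟩ := h n hn j hjn
    refine ⟨M, hM, ?_⟩
    rw [meshPoint_of_le (show j + 1 ≤ n by omega), meshPoint_of_le (show j ≤ n by omega)]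
    exact ⟨h1, h2⟩
  -- Cell j of the right half is the image of cell 2n - (j + 1) under x ↦ π - x.
  · obtain ⟨M, hM, h1, -, h2⟩ := h n hn (2 * n - (j + 1)) (by omega)
    refine ⟨M, hM, ?_⟩
    rw [meshPoint_of_ge hn (show n ≤ j + 1 by omega), meshPoint_of_ge hn (show n ≤ j by omega)]
    rw [show 2 * n - (j + 1) + 1 = 2 * n - j by omega] at h1 h2
    refine ⟨?_, h2⟩
    rwa [sub_sub_sub_cancel_left]

end Coefficient

/-! ### Separability off the diagonal and quadratic approximation of T -/

/-- The part of a cell of the mesh, taken on both sides of `0`. -/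
def symmetricCell (a b : ℝ) : Set ℝ := {x | a < |x| ∧ |x| ≤ b ∧ |x| < Real.pi}

theorem measurableSet_symmetricCell (a b : ℝ) : MeasurableSet (symmetricCell a b) :=
  (measurableSet_lt measurable_const measurable_abs).inter
    ((measurableSet_le measurable_abs measurable_const).inter
      (measurableSet_lt measurable_abs measurable_const))

theorem circMeasure_symmetricCell_le {a b : ℝ} (hab : a ≤ b) :
    circMeasure.real (symmetricCell a b) ≤ 2 * (b - a) := by
  have hsub : symmetricCell a b ⊆ Ioc a b ∪ Ico (-b) (-a) := by
    rintro x ⟨h1, h2, -⟩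
    rcases abs_cases x with ⟨h, _⟩ | ⟨h, _⟩ <;> rw [h] at h1 h2
    · exact Or.inl ⟨h1, h2⟩
    · exact Or.inr ⟨by linarith, by linarith⟩
  have h1 : circMeasure (symmetricCell a b) ≤ ENNReal.ofReal (2 * (b - a)) := by
    calc circMeasure (symmetricCell a b) ≤ volume (symmetricCell a b) := Measure.restrict_apply_le _ _
      _ ≤ volume (Ioc a b ∪ Ico (-b) (-a)) := measure_mono hsub
      _ ≤ volume (Ioc a b) + volume (Ico (-b) (-a)) := measure_union_le _ _
      _ = ENNReal.ofReal (2 * (b - a)) := by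
        rw [Real.volume_Ioc, Real.volume_Ico, ← ENNReal.ofReal_add (by linarith) (by linarith)]
        congr 1; ring
  exact ENNReal.toReal_le_of_le_ofReal (by linarith) h1

/-- The first factor `ω (t) / ω (x)` of the kernel off the diagonal, for `t < x`. -/
noncomputable def rightFactor (f : ℝ → ℝ) (ε t : ℝ) : ℝ → ℝ :=
  {x | 0 < t ∧ t < x ∧ x < Real.pi}.indicator fun x => expPhase f ε t / expPhase f ε x

/-- The second factor `ω (y) / ω (t)` of the kernel off the diagonal, for `y ≤ t`. -/
noncomputable def leftFactor (f : ℝ → ℝ) (ε t : ℝ) : ℝ → ℝ :=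
  {y | 0 < y ∧ y ≤ t ∧ t < Real.pi}.indicator fun y => expPhase f ε y / expPhase f ε t

theorem memLp_of_measurable_of_abs_le {α : Type*} [MeasurableSpace α] {μ : Measure α}
    [IsFiniteMeasure μ] {g : α → ℝ} (hg : Measurable g) {C : ℝ} (hC : ∀ x, |g x| ≤ C) :
    MemLp (fun x => (g x : ℂ)) 2 μ :=
  MemLp.of_bound (Complex.measurable_ofReal.comp hg).aestronglyMeasurable C
    (Eventually.of_forall fun x => by simpa using hC x)

namespace Coefficient

variable {f : ℝ → ℝ} (hf : Coefficient f) {ε : ℝ} (hε : 0 < ε)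
include hf hε

theorem measurable_rightFactor (t : ℝ) : Measurable (rightFactor f ε t) := by
  refine ContinuousOn.measurable_indicator ?_ ?_
  · exact continuousOn_const.div ((hf.expPhase_continuousOn hε).mono
      fun x hx => ⟨hx.1.trans hx.2.1, hx.2.2⟩) fun x _ => (expPhase_pos f ε x).ne'
  · exact (MeasurableSet.const _).inter
      ((measurableSet_lt measurable_const measurable_id).inter
        (measurableSet_lt measurable_id measurable_const))

theorem abs_rightFactor_le (t x : ℝ) : |rightFactor f ε t x| ≤ 1 := by
  unfold rightFactor
  by_cases h : x ∈ {x | 0 < t ∧ t < x ∧ x < Real.pi}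
  · rw [indicator_of_mem h, abs_of_pos (div_pos (expPhase_pos _ _ _) (expPhase_pos _ _ _))]
    exact hf.expPhase_div_le_one hε h.1 h.2.1.le h.2.2
  · rw [indicator_of_notMem h]; simp

theorem measurable_leftFactor (t : ℝ) : Measurable (leftFactor f ε t) := by
  refine ContinuousOn.measurable_indicator ?_ ?_
  · exact ContinuousOn.div ((hf.expPhase_continuousOn hε).mono
      fun y hy => ⟨hy.1, hy.2.1.trans_lt hy.2.2⟩) continuousOn_const
      fun x _ => (expPhase_pos f ε t).ne'
  · exact (measurableSet_lt measurable_const measurable_id).inter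
      ((measurableSet_le measurable_id measurable_const).inter (MeasurableSet.const _))

theorem abs_leftFactor_le (t y : ℝ) : |leftFactor f ε t y| ≤ 1 := by
  unfold leftFactor
  by_cases h : y ∈ {y | 0 < y ∧ y ≤ t ∧ t < Real.pi}
  · rw [indicator_of_mem h, abs_of_pos (div_pos (expPhase_pos _ _ _) (expPhase_pos _ _ _))]
    exact hf.expPhase_div_le_one hε h.1 h.2.1 h.2.2
  · rw [indicator_of_notMem h]; simp

-- If x is in the cell and y is not, then either 0 < y ≤ a < x and ω(y)/ω(x) factors through ω(a),
-- or the kernel vanishes. Passing through ω(a) keeps both factors at most 1, whereas ω and 1/ω are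
-- unbounded, near π and near 0 respectively.
omit hf hε in
theorem halfKernel_eq_of_notMem_cell {a b x y : ℝ} (hx : x ∈ symmetricCell a b)
    (hy : y ∉ symmetricCell a b) :
    halfKernel f ε (x, y) = (Ioi (0 : ℝ)).indicator 1 x * (Ioc 0 a).indicator 1 y
      - rightFactor f ε a x * leftFactor f ε a y := by
  obtain ⟨h1, h2, h3⟩ := hx
  by_cases hx0 : 0 < x
  · rw [abs_of_pos hx0] at h1 h2 h3
    by_cases hya : y ∈ Ioc 0 a
    · have hm : (x, y) ∈ upperTriangle := ⟨hya.1, hya.2.trans_lt h1, h3⟩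
      have ha0 : 0 < a := hya.1.trans_le hya.2
      rw [halfKernel, indicator_of_mem hm, indicator_of_mem (show x ∈ Ioi (0 : ℝ) from hx0),
        indicator_of_mem hya, rightFactor, leftFactor,
        indicator_of_mem (show x ∈ {x | 0 < a ∧ a < x ∧ x < Real.pi} from ⟨ha0, h1, h3⟩),
        indicator_of_mem (show y ∈ {y | 0 < y ∧ y ≤ a ∧ a < Real.pi} from
          ⟨hya.1, hya.2, h1.trans h3⟩)]
      have e1 := (expPhase_pos f ε a).ne'
      have e2 := (expPhase_pos f ε x).ne'
      simp only [Pi.one_apply]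
      field_simp
    · have hm : (x, y) ∉ upperTriangle := fun h => by
        have h4 : a < y := by
          by_contra hcon
          exact hya ⟨h.1, not_lt.mp hcon⟩
        refine hy ⟨?_, ?_, ?_⟩ <;> rw [abs_of_pos h.1]
        exacts [h4, h.2.1.le.trans h2, h.2.1.trans h3]
      rw [halfKernel, indicator_of_notMem hm, indicator_of_notMem hya, leftFactor,
        indicator_of_notMem (show y ∉ {y | 0 < y ∧ y ≤ a ∧ a < Real.pi} from
          fun h => hya ⟨h.1, h.2.1⟩)]
      ring
  · have hm : (x, y) ∉ upperTriangle := fun h => hx0 (h.1.trans h.2.1)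
    rw [halfKernel, indicator_of_notMem hm, indicator_of_notMem (show x ∉ Ioi (0 : ℝ) from hx0),
      rightFactor, indicator_of_notMem (show x ∉ {x | 0 < a ∧ a < x ∧ x < Real.pi} from
        fun h => hx0 (h.1.trans h.2.1))]
    ring

omit hf hε in
theorem halfKernel_le_of_mem_cell {a b M x y : ℝ} (hM : 0 ≤ M)
    (hbd : ∀ y x, a < y → y < x → x ≤ b → x < Real.pi →
      1 - expPhase f ε y / expPhase f ε x ≤ M)
    (hx : x ∈ symmetricCell a b) (hy : y ∈ symmetricCell a b) : halfKernel f ε (x, y) ≤ M := by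
  by_cases h : (x, y) ∈ upperTriangle
  · rw [halfKernel, indicator_of_mem h]
    have hx0 : 0 < x := h.1.trans h.2.1
    have h1 := hy.1
    have h2 := hx.2.1
    rw [abs_of_pos h.1] at h1
    rw [abs_of_pos hx0] at h2
    exact hbd y x h1 h.2.1 h2 h.2.2
  · rwa [halfKernel, indicator_of_notMem h]

omit hf hε in
theorem neg_mem_symmetricCell {a b x : ℝ} : -x ∈ symmetricCell a b ↔ x ∈ symmetricCell a b := by
  simp [symmetricCell]

theorem norm_phaseKernel_le_of_mem_cell {a b M x y : ℝ} (hM : 0 ≤ M)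
    (hbd : ∀ y x, a < y → y < x → x ≤ b → x < Real.pi →
      1 - expPhase f ε y / expPhase f ε x ≤ M)
    (hx : x ∈ symmetricCell a b) (hy : y ∈ symmetricCell a b) : ‖phaseKernel f ε x y‖ ≤ M := by
  have h1 := halfKernel_le_of_mem_cell hM hbd hx hy
  have h2 := halfKernel_le_of_mem_cell hM hbd (neg_mem_symmetricCell.mpr hx)
    (neg_mem_symmetricCell.mpr hy)
  have h3 := (hf.halfKernel_mem_Icc hε (x, y)).1
  have h4 := (hf.halfKernel_mem_Icc hε (-x, -y)).1
  rw [phaseKernel, Complex.norm_real, Real.norm_eq_abs, abs_le]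
  exact ⟨by linarith, by linarith⟩

/-- Each of the 2n rows carries four separable terms, two for either sign of x, whence rank at most
8n. The diagonal blocks contribute O(n⁻²). -/
theorem quadraticApprox_of_kernel {T : L2 →L[ℂ] L2}
    (hT : IsIntegralOperator (phaseKernel f ε) T) : QuadraticApprox T := by
  obtain ⟨C, hC, hcell⟩ := hf.exists_mesh_cell_bound hε
  refine ⟨C, 8, fun n hn => ?_⟩
  choose! M hM hMδ hbd using hcell n hn
  let E : Fin (2 * n) → Set ℝ := fun j => symmetricCell (meshPoint n j) (meshPoint n (j + 1))
  let a : Fin (2 * n) → Fin 4 → ℝ → ℝ := fun j =>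
    ![(Ioi (0 : ℝ)).indicator 1, fun x => -rightFactor f ε (meshPoint n j) x,
      fun x => -(Ioi (0 : ℝ)).indicator 1 (-x), fun x => rightFactor f ε (meshPoint n j) (-x)]
  let c : Fin (2 * n) → Fin 4 → ℝ → ℝ := fun j =>
    ![(Ioc 0 (meshPoint n j)).indicator 1, leftFactor f ε (meshPoint n j),
      fun y => (Ioc 0 (meshPoint n j)).indicator 1 (-y),
      fun y => leftFactor f ε (meshPoint n j) (-y)]
  have hind : ∀ (s : Set ℝ) (x : ℝ), |s.indicator (1 : ℝ → ℝ) x| ≤ 1 := fun s x => by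
    by_cases h : x ∈ s <;> simp [h]
  have hindm : ∀ s : Set ℝ, MeasurableSet s → Measurable (s.indicator (1 : ℝ → ℝ)) :=
    fun s hs => measurable_one.indicator hs
  have key := exists_rank_le_norm_sub_le (μ := circMeasure) hT (E := E) (M := fun j => M j)
    (δ := C / (n : ℝ) ^ 2) (a := fun j k x => (a j k x : ℂ)) (c := fun j k x => (c j k x : ℂ))
    (fun j => measurableSet_symmetricCell _ _) ?_ ?_ (fun j => hM j j.2) (by positivity) ?_ ?_
    ?_ ?_ ?_
  · obtain ⟨A, hr, hA⟩ := key
    refine ⟨A, hr.trans (le_of_eq ?_), hA⟩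
    congr 1
    simp
    ring
  · intro i j hij
    have h := (meshPoint_mono hn).pairwise_disjoint_on_Ioc_succ
      (show (i : ℕ) ≠ j from fun h => hij (Fin.ext h))
    refine Set.disjoint_left.mpr fun x hx hx' => ?_
    exact Set.disjoint_left.mp h (show |x| ∈ Ioc _ _ from ⟨hx.1, hx.2.1⟩) ⟨hx'.1, hx'.2.1⟩
  -- The cells are open on the inner side, so 0 belongs to none of them.
  · have h0 : ∀ᵐ x ∂circMeasure, x ≠ 0 := ae_restrict_of_ae
      (compl_mem_ae_iff.mpr (measure_singleton (μ := volume) (0 : ℝ)))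
    filter_upwards [h0, ae_restrict_mem measurableSet_Ioo] with x hx0 hx
    have hx' : |x| < Real.pi := abs_lt.mpr hx
    have h := (meshPoint_mono hn).biUnion_Ico_Ioc_map_succ 0 (2 * n)
    rw [meshPoint_zero, meshPoint_two_mul hn] at h
    have hmem : |x| ∈ Ioc 0 Real.pi := ⟨abs_pos.mpr hx0, hx'.le⟩
    rw [← h] at hmem
    simp only [mem_iUnion] at hmem
    obtain ⟨j, hj, hjx⟩ := hmem
    exact ⟨⟨j, hj.2⟩, hjx.1, hjx.2, hx'⟩
  · intro j
    refine (mul_le_mul_of_nonneg_left (circMeasure_symmetricCell_le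
      (meshPoint_mono hn (Nat.le_succ _))) (hM j j.2)).trans (hMδ j j.2)
  · intro j x hx y hy
    exact hf.norm_phaseKernel_le_of_mem_cell hε (hM j j.2) (hbd j j.2) hx hy
  · intro j k
    refine memLp_of_measurable_of_abs_le (C := 1) ?_ ?_
    · fin_cases k
      · exact hindm _ measurableSet_Ioi
      · exact (hf.measurable_rightFactor hε _).neg
      · exact ((hindm _ measurableSet_Ioi).comp measurable_neg).neg
      · exact (hf.measurable_rightFactor hε _).comp measurable_neg
    · intro x
      fin_cases k
      · exact hind _ _
      · exact (abs_neg _).le.trans (hf.abs_rightFactor_le hε _ _)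
      · exact (abs_neg _).le.trans (hind _ _)
      · exact hf.abs_rightFactor_le hε _ _
  · intro j k
    refine memLp_of_measurable_of_abs_le (C := 1) ?_ ?_
    · fin_cases k
      · exact hindm _ measurableSet_Ioc
      · exact hf.measurable_leftFactor hε _
      · exact (hindm _ measurableSet_Ioc).comp measurable_neg
      · exact (hf.measurable_leftFactor hε _).comp measurable_neg
    · intro x
      fin_cases k
      · exact hind _ _
      · exact hf.abs_leftFactor_le hε _ _
      · exact hind _ _
      · exact hf.abs_leftFactor_le hε _ _
  · intro j x hx
    refine Eventually.of_forall fun y hy => ?_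
    rw [phaseKernel, halfKernel_eq_of_notMem_cell hx hy,
      halfKernel_eq_of_notMem_cell (neg_mem_symmetricCell.mpr hx)
        (fun h => hy (neg_mem_symmetricCell.mp h))]
    simp only [Fin.sum_univ_four, a, c, Matrix.cons_val]
    push_cast
    ring

end Coefficient

end SingularSL

/-! ### Absolute continuity of complex-valued functions -/

namespace AbsolutelyContinuousOnInterval

theorem congr {X : Type*} [PseudoMetricSpace X] {v w : ℝ → X} {a b : ℝ}
    (h : AbsolutelyContinuousOnInterval v a b) (hvw : EqOn v w (uIcc a b)) :
    AbsolutelyContinuousOnInterval w a b := by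
  rw [absolutelyContinuousOnInterval_iff] at h ⊢
  intro ε hε
  obtain ⟨δ, hδ, hE⟩ := h ε hε
  refine ⟨δ, hδ, fun E hEd hlt => ?_⟩
  have := hE E hEd hlt
  rwa [Finset.sum_congr rfl fun i hi => by
    rw [hvw (hEd.1 i hi).1, hvw (hEd.1 i hi).2]] at this

theorem comp_neg {X : Type*} [PseudoMetricSpace X] {v : ℝ → X} {a b : ℝ}
    (h : AbsolutelyContinuousOnInterval v (-a) (-b)) :
    AbsolutelyContinuousOnInterval (fun x => v (-x)) a b := by
  rw [absolutelyContinuousOnInterval_iff] at h ⊢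
  intro ε hε
  obtain ⟨δ, hδ, hE⟩ := h ε hε
  refine ⟨δ, hδ, fun E hEd hlt => ?_⟩
  refine hE (E.1, fun i => (-(E.2 i).1, -(E.2 i).2)) ⟨fun i hi => ?_, fun i hi j hj hij => ?_⟩ ?_
  · have := hEd.1 i hi
    rw [← image_neg_uIcc]
    exact ⟨⟨_, this.1, rfl⟩, ⟨_, this.2, rfl⟩⟩
  -- Negation reverses which end of the interval is open, but disjointness of two left-open
  -- intervals is a comparison of max and min of their endpoints, which negation preserves.
  · have := hEd.2 hi hj hij
    simp only [Function.onFun, uIoc, Ioc_disjoint_Ioc, max_neg_neg, min_neg_neg, neg_le_neg_iff]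
      at this ⊢
    exact this
  · simpa only [dist_neg_neg] using hlt

theorem comp_lipschitzWith {X Y : Type*} [PseudoMetricSpace X] [PseudoMetricSpace Y] {v : ℝ → X}
    {a b : ℝ} (h : AbsolutelyContinuousOnInterval v a b) {g : X → Y} (hg : LipschitzWith 1 g) :
    AbsolutelyContinuousOnInterval (fun x => g (v x)) a b := by
  rw [absolutelyContinuousOnInterval_iff] at h ⊢
  intro ε hε
  obtain ⟨δ, hδ, hE⟩ := h ε hε
  refine ⟨δ, hδ, fun E hEd hlt => lt_of_le_of_lt (Finset.sum_le_sum fun i _ => ?_) (hE E hEd hlt)⟩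
  simpa using hg.dist_le_mul (v (E.2 i).1) (v (E.2 i).2)

theorem const {X : Type*} [PseudoMetricSpace X] (c : X) (a b : ℝ) :
    AbsolutelyContinuousOnInterval (fun _ => c) a b :=
  ((LipschitzWith.const c).lipschitzOnWith).absolutelyContinuousOnInterval

/-- Real and imaginary parts are 1-Lipschitz images of v, to which the real theorem applies. -/
theorem ae_differentiableAt_complex {v : ℝ → ℂ} {a b : ℝ}
    (h : AbsolutelyContinuousOnInterval v a b) : ∀ᵐ x, x ∈ uIcc a b → DifferentiableAt ℝ v x := by
  have hre : LipschitzWith 1 Complex.re := LipschitzWith.of_dist_le_mul fun z w => by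
    rw [Real.dist_eq, dist_eq_norm, NNReal.coe_one, one_mul, ← Complex.sub_re]
    exact Complex.abs_re_le_norm _
  have him : LipschitzWith 1 Complex.im := LipschitzWith.of_dist_le_mul fun z w => by
    rw [Real.dist_eq, dist_eq_norm, NNReal.coe_one, one_mul, ← Complex.sub_im]
    exact Complex.abs_im_le_norm _
  filter_upwards [(h.comp_lipschitzWith hre).ae_differentiableAt,
    (h.comp_lipschitzWith him).ae_differentiableAt] with x h1 h2 hx
  have h3 : DifferentiableAt ℝ (fun x => ((v x).re : ℂ) + ((v x).im : ℂ) * Complex.I) x :=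
    (Complex.ofRealCLM.differentiableAt.comp x (h1 hx)).add
      ((Complex.ofRealCLM.differentiableAt.comp x (h2 hx)).mul_const _)
  simpa only [Complex.re_add_im] using h3

theorem of_integral {g : ℝ → ℂ} {a b c : ℝ} (hg : IntervalIntegrable g volume a b)
    (hc : c ∈ uIcc a b) : AbsolutelyContinuousOnInterval (fun x => ∫ t in c..x, g t) a b := by
  have hre : IntervalIntegrable (fun t => (g t).re) volume a b := ⟨hg.1.re, hg.2.re⟩
  have him : IntervalIntegrable (fun t => (g t).im) volume a b := ⟨hg.1.im, hg.2.im⟩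
  have hlip : LipschitzWith 1 (fun x : ℝ => (x : ℂ)) := Complex.isometry_ofReal.lipschitz
  have h1 := (hre.absolutelyContinuousOnInterval_intervalIntegral hc).comp_lipschitzWith hlip
  have h2 := (him.absolutelyContinuousOnInterval_intervalIntegral hc).comp_lipschitzWith hlip
  refine (h1.fun_add (h2.fun_smul (const Complex.I a b))).congr fun x hx => ?_
  have hgx : IntervalIntegrable g volume c x :=
    hg.mono_set (ordConnected_uIcc.uIcc_subset hc hx)
  have e1 := Complex.reCLM.intervalIntegral_comp_comm hgx
  have e2 := Complex.imCLM.intervalIntegral_comp_comm hgx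
  simp only [Complex.reCLM_apply, Complex.imCLM_apply] at e1 e2
  simp only [e1, e2, smul_eq_mul, Complex.re_add_im]

theorem of_hasDerivAt {v g : ℝ → ℂ} {a b : ℝ} {s : Set ℝ} (hs : s.Countable)
    (hv : ContinuousOn v (uIcc a b)) (hd : ∀ x ∈ uIcc a b \ s, HasDerivAt v (g x) x)
    (hg : IntervalIntegrable g volume a b) : AbsolutelyContinuousOnInterval v a b := by
  refine ((const (v a) a b).fun_add (of_integral hg left_mem_uIcc)).congr fun x hx => ?_
  have hsub : uIcc a x ⊆ uIcc a b := uIcc_subset_uIcc_left hx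
  have h := integral_eq_of_hasDerivAt_off_countable v g hs (hv.mono hsub)
    (fun t ht => hd t ⟨hsub (Ioo_subset_Icc_self ht.1), ht.2⟩) (hg.mono_set hsub)
  simp only [h]
  ring

/-- The difference between v and the primitive of g is absolutely continuous with derivative zero
almost everywhere, hence constant. -/
theorem sub_eq_integral {v g : ℝ → ℂ} {a b : ℝ} (h : AbsolutelyContinuousOnInterval v a b)
    (hg : IntervalIntegrable g volume a b)
    (hd : ∀ᵐ x, x ∈ uIcc a b → HasDerivAt v (g x) x) : v b - v a = ∫ x in a..b, g x := by
  have hac := h.fun_sub (of_integral hg left_mem_uIcc)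
  obtain ⟨C, hC⟩ := hac.const_of_ae_hasDerivAt_zero (by
    filter_upwards [hd, hg.ae_hasDerivAt_integral] with x h1 h2 hx
    simpa using (h1 hx).fun_sub (h2 hx a left_mem_uIcc))
  have h1 := hC a left_mem_uIcc
  have h2 := hC b right_mem_uIcc
  simp only [intervalIntegral.integral_same] at h1
  rw [sub_eq_iff_eq_add] at h2
  rw [h2, ← h1]
  ring

end AbsolutelyContinuousOnInterval

/-! ### Local absolute continuity on open intervals -/

namespace SingularSL

theorem ACLoc.mono {v : ℝ → ℂ} {J J' : Set ℝ} (h : ACLoc v J) (hJ : J' ⊆ J) : ACLoc v J' :=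
  fun a b hab hsub => h a b hab (hsub.trans hJ)

theorem ACLoc.on_uIcc {v : ℝ → ℂ} {J : Set ℝ} (h : ACLoc v J) {a b : ℝ} (hab : uIcc a b ⊆ J) :
    AbsolutelyContinuousOnInterval v a b := by
  rcases le_total a b with hle | hle
  · rw [uIcc_of_le hle] at hab
    exact h a b hle hab
  · rw [uIcc_of_ge hle] at hab
    exact (h b a hle hab).symm

theorem ACLoc.continuousOn {v : ℝ → ℂ} {a b : ℝ} (h : ACLoc v (Ioo a b)) :
    ContinuousOn v (Ioo a b) := by
  intro x hx
  obtain ⟨c, hac, hcx⟩ := exists_between hx.1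
  obtain ⟨d, hxd, hdb⟩ := exists_between hx.2
  have hcd : c ≤ d := (hcx.trans hxd).le
  have h1 := (h c d hcd fun t ht => ⟨hac.trans_le ht.1, ht.2.trans_lt hdb⟩).continuousOn
  rw [uIcc_of_le hcd] at h1
  exact (h1.continuousAt (Icc_mem_nhds hcx hxd)).continuousWithinAt

/-- The open interval is the union of the countably many intervals [a + 1/(n+1), b - 1/(n+1)], so
the exceptional null sets can be collected. -/
theorem ae_of_forall_compact_subinterval {a b : ℝ} {P : ℝ → Prop}
    (h : ∀ c d, c ≤ d → Icc c d ⊆ Ioo a b → ∀ᵐ x, x ∈ Icc c d → P x) :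
    ∀ᵐ x, x ∈ Ioo a b → P x := by
  have h1 : ∀ n : ℕ, ∀ᵐ x, x ∈ Icc (a + 1 / (n + 1)) (b - 1 / (n + 1)) → P x := by
    intro n
    rcases le_total (a + 1 / (n + 1 : ℝ)) (b - 1 / (n + 1)) with hle | hle
    · have hpos : (0 : ℝ) < 1 / (n + 1) := by positivity
      exact h _ _ hle fun x hx => ⟨by linarith [hx.1], by linarith [hx.2]⟩
    · rcases hle.eq_or_lt with he | hlt
      · have hpos : (0 : ℝ) < 1 / (n + 1) := by positivity
        exact h _ _ he.ge fun x hx => ⟨by linarith [hx.1], by linarith [hx.2]⟩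
      · rw [Icc_eq_empty (not_le.mpr hlt)]
        simp
  filter_upwards [ae_all_iff.mpr h1] with x hx hxab
  obtain ⟨n, hn⟩ := exists_nat_one_div_lt (lt_min (sub_pos.mpr hxab.1) (sub_pos.mpr hxab.2))
  have h2 := lt_min_iff.mp hn
  exact hx n ⟨by linarith [h2.1], by linarith [h2.2]⟩

theorem ACLoc.ae_differentiableAt {v : ℝ → ℂ} {a b : ℝ} (h : ACLoc v (Ioo a b)) :
    ∀ᵐ x, x ∈ Ioo a b → DifferentiableAt ℝ v x :=
  ae_of_forall_compact_subinterval fun c d hcd hsub => by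
    have := (h c d hcd hsub).ae_differentiableAt_complex
    rwa [uIcc_of_le hcd] at this

/-- A locally absolutely continuous function whose derivative is almost everywhere equal to a
continuous function is differentiable everywhere, with that derivative. -/
theorem ACLoc.hasDerivAt {v g : ℝ → ℂ} {a b : ℝ} (h : ACLoc v (Ioo a b))
    (hg : ContinuousOn g (Ioo a b)) (hd : ∀ᵐ x, x ∈ Ioo a b → HasDerivAt v (g x) x) :
    ∀ x ∈ Ioo a b, HasDerivAt v (g x) x := by
  intro x hx
  have hsub : ∀ y ∈ Ioo a b, uIcc x y ⊆ Ioo a b := fun y hy => ordConnected_Ioo.uIcc_subset hx hy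
  have heq : ∀ y ∈ Ioo a b, v y = v x + ∫ t in x..y, g t := fun y hy => by
    have := (h.on_uIcc (hsub y hy)).sub_eq_integral ((hg.mono (hsub y hy)).intervalIntegrable)
      (by filter_upwards [hd] with t ht hty using ht (hsub y hy hty))
    rw [← this]; ring
  have h1 : HasDerivAt (fun y => v x + ∫ t in x..y, g t) (g x) x :=
    (intervalIntegral.integral_hasDerivAt_right (by simp)
      (hg.stronglyMeasurableAtFilter isOpen_Ioo x hx)
      (hg.continuousAt (Ioo_mem_nhds hx.1 hx.2))).const_add _
  refine h1.congr_of_eventuallyEq ?_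
  filter_upwards [Ioo_mem_nhds hx.1 hx.2] with y hy using heq y hy

theorem ACLoc.of_eqOn {v w : ℝ → ℂ} {J : Set ℝ} (h : ACLoc v J) (hvw : EqOn v w J) : ACLoc w J :=
  fun a b hab hsub => (h a b hab hsub).congr (by rw [uIcc_of_le hab]; exact hvw.mono hsub)

theorem ACLoc.comp_neg {v : ℝ → ℂ} {J : Set ℝ} (h : ACLoc v J) :
    ACLoc (fun x => v (-x)) (Neg.neg ⁻¹' J) := by
  intro a b hab hsub
  refine (h.on_uIcc (a := -a) (b := -b) ?_).comp_neg
  intro x hx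
  rw [← image_neg_uIcc, uIcc_of_le hab] at hx
  obtain ⟨y, hy, rfl⟩ := hx
  exact hsub hy

/-! ### The equation on the half interval (0, π) -/

/-- The function `x ↦ ω(x)⁻¹ ∫₀ˣ ω F`. -/
noncomputable def weightedPrimitive (f : ℝ → ℝ) (ε : ℝ) (F : ℝ → ℂ) (x : ℝ) : ℂ :=
  (∫ y in (0 : ℝ)..x, (expPhase f ε y : ℂ) * F y) / (expPhase f ε x : ℂ)

/-- The solution of `ε f u' + u = ∫₀ˣ F` on `(0, π)` that vanishes at `0`. -/
noncomputable def halfSolution (f : ℝ → ℝ) (ε : ℝ) (F : ℝ → ℂ) (x : ℝ) : ℂ :=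
  (∫ y in (0 : ℝ)..x, F y) - weightedPrimitive f ε F x

theorem expPhase_ofReal_ne_zero (f : ℝ → ℝ) (ε x : ℝ) : (expPhase f ε x : ℂ) ≠ 0 := by
  exact_mod_cast (expPhase_pos f ε x).ne'

theorem ae_hasDerivAt_integral_Ioo {g : ℝ → ℂ} {a b : ℝ}
    (hg : ∀ x ∈ Ioo a b, IntervalIntegrable g volume a x) :
    ∀ᵐ x, x ∈ Ioo a b → HasDerivAt (fun x => ∫ t in a..x, g t) (g x) x := by
  refine ae_of_forall_compact_subinterval fun c d hcd hsub => ?_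
  have hc := hsub (left_mem_Icc.mpr hcd)
  have hd := hsub (right_mem_Icc.mpr hcd)
  filter_upwards [(hg d hd).ae_hasDerivAt_integral] with x hx hxcd
  refine hx ?_ a left_mem_uIcc
  rw [uIcc_of_le hd.1.le]
  exact ⟨hc.1.le.trans hxcd.1, hxcd.2⟩

theorem acLoc_integral {g : ℝ → ℂ} {a b : ℝ}
    (hg : ∀ x ∈ Ioo a b, IntervalIntegrable g volume a x) :
    ACLoc (fun x => ∫ t in a..x, g t) (Ioo a b) := by
  intro c d hcd hsub
  have hc := hsub (left_mem_Icc.mpr hcd)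
  have hd := hsub (right_mem_Icc.mpr hcd)
  refine (AbsolutelyContinuousOnInterval.of_integral (hg d hd) left_mem_uIcc).mono ?_
  rw [uIcc_of_le hcd, uIcc_of_le hd.1.le]
  exact Icc_subset_Icc_left hc.1.le

theorem intervalIntegrable_left_mono {g : ℝ → ℂ} {a b : ℝ} (hg : IntervalIntegrable g volume a b)
    {x : ℝ} (hx : x ∈ Icc a b) : IntervalIntegrable g volume a x :=
  hg.mono_set (by
    rw [uIcc_of_le hx.1, uIcc_of_le (hx.1.trans hx.2)]
    exact Icc_subset_Icc_right hx.2)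

theorem tendsto_integral_right_zero {F : ℝ → ℂ} {b : ℝ} (hb : 0 < b)
    (hF : IntervalIntegrable F volume 0 b) :
    Tendsto (fun x => ∫ y in (0 : ℝ)..x, ‖F y‖) (𝓝[>] 0) (𝓝 0) := by
  have h := intervalIntegral.continuousOn_primitive_interval' hF.norm left_mem_uIcc
  have h0 := h 0 left_mem_uIcc
  rw [ContinuousWithinAt, intervalIntegral.integral_same, uIcc_of_le hb.le] at h0
  exact h0.mono_left (nhdsWithin_le_of_mem (Icc_mem_nhdsGT hb))

theorem norm_integral_zero_le {F : ℝ → ℂ} {x : ℝ} (hx : 0 ≤ x) :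
    ‖∫ y in (0 : ℝ)..x, F y‖ ≤ ∫ y in (0 : ℝ)..x, ‖F y‖ :=
  intervalIntegral.norm_integral_le_integral_norm hx

namespace Coefficient

variable {f : ℝ → ℝ} (hf : Coefficient f) {ε : ℝ} (hε : 0 < ε)
include hf

theorem ofReal_ne_zero {x : ℝ} (hx : x ∈ Ioo 0 Real.pi) : (f x : ℂ) ≠ 0 := by
  exact_mod_cast (hf.pos x hx).ne'

include hε

theorem hasDerivAt_expPhase {x : ℝ} (hx : x ∈ Ioo 0 Real.pi) :
    HasDerivAt (fun x => (expPhase f ε x : ℂ)) ((expPhase f ε x : ℂ) / (ε * f x)) x := by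
  have h1 : HasDerivAt (expPhase f ε) (Real.exp (phase f ε x) * (1 / (ε * f x))) x := by
    refine (hf.phase_hasDerivAt hε hx).exp.congr_of_eventuallyEq ?_
    filter_upwards [Ioo_mem_nhds hx.1 hx.2] with y hy using expPhase_of_pos f ε hy.1
  have h2 := h1.ofReal_comp
  rw [← expPhase_of_pos f ε hx.1] at h2
  convert h2 using 1
  push_cast
  ring

theorem continuousOn_ofReal_expPhase :
    ContinuousOn (fun x => (expPhase f ε x : ℂ)) (Ioo 0 Real.pi) := fun _ hx =>
  (hf.hasDerivAt_expPhase hε hx).continuousAt.continuousWithinAt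

omit hε in
theorem continuousOn_div_coefficient (hε' : ε ≠ 0) {g : ℝ → ℂ}
    (hg : ContinuousOn g (Ioo 0 Real.pi)) :
    ContinuousOn (fun x => g x / (ε * f x)) (Ioo 0 Real.pi) :=
  hg.div (continuousOn_const.mul (Complex.continuous_ofReal.comp hf.continuous).continuousOn)
    fun x hx => mul_ne_zero (by exact_mod_cast hε') (hf.ofReal_ne_zero hx)

theorem acLoc_inv_expPhase : ACLoc (fun x => ((expPhase f ε x : ℂ))⁻¹) (Ioo 0 Real.pi) := by
  intro a b hab hsub
  have hd : ∀ x ∈ Ioo 0 Real.pi, HasDerivAt (fun x => ((expPhase f ε x : ℂ))⁻¹)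
      (-((expPhase f ε x : ℂ) / (ε * f x)) / (expPhase f ε x : ℂ) ^ 2) x := fun x hx =>
    (hf.hasDerivAt_expPhase hε hx).fun_inv (expPhase_ofReal_ne_zero f ε x)
  refine AbsolutelyContinuousOnInterval.of_hasDerivAt (s := ∅) countable_empty ?_
    (g := fun x => -((expPhase f ε x : ℂ) / (ε * f x)) / (expPhase f ε x : ℂ) ^ 2) ?_ ?_
  · rw [uIcc_of_le hab]
    exact fun x hx => (hd x (hsub hx)).continuousAt.continuousWithinAt
  · rw [uIcc_of_le hab]
    exact fun x hx => hd x (hsub hx.1)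
  · refine ContinuousOn.intervalIntegrable ?_
    rw [uIcc_of_le hab]
    refine ContinuousOn.mono ?_ hsub
    exact ((hf.continuousOn_div_coefficient hε.ne' (hf.continuousOn_ofReal_expPhase hε)).neg).div
      ((hf.continuousOn_ofReal_expPhase hε).pow 2)
      fun x _ => pow_ne_zero 2 (expPhase_ofReal_ne_zero f ε x)

variable {F : ℝ → ℂ} (hF : IntervalIntegrable F volume 0 Real.pi)
include hF

omit hε hf in
theorem intervalIntegrable_left {x : ℝ} (hx : x ∈ Ioo 0 Real.pi) :
    IntervalIntegrable F volume 0 x :=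
  intervalIntegrable_left_mono hF (Ioo_subset_Icc_self hx)

omit hF in
theorem norm_expPhase_mul_le {x y : ℝ} (hx : x ∈ Ioo 0 Real.pi) (hy : y ∈ Ioc 0 x) :
    ‖(expPhase f ε y : ℂ) * F y‖ ≤ expPhase f ε x * ‖F y‖ := by
  rw [norm_mul, Complex.norm_real, Real.norm_of_nonneg (expPhase_pos f ε y).le]
  exact mul_le_mul_of_nonneg_right (hf.expPhase_mono hε hy.1 hy.2 hx.2) (norm_nonneg _)

theorem intervalIntegrable_expPhase_mul {x : ℝ} (hx : x ∈ Ioo 0 Real.pi) :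
    IntervalIntegrable (fun y => (expPhase f ε y : ℂ) * F y) volume 0 x := by
  have hFx := intervalIntegrable_left hF hx
  rw [intervalIntegrable_iff_integrableOn_Ioc_of_le hx.1.le] at hFx ⊢
  refine Integrable.bdd_mul (c := expPhase f ε x) hFx ?_ ?_
  · exact ((hf.continuousOn_ofReal_expPhase hε).mono fun y hy =>
      ⟨hy.1, hy.2.trans_lt hx.2⟩).aestronglyMeasurable measurableSet_Ioc
  · filter_upwards [ae_restrict_mem measurableSet_Ioc] with y hy
    rw [Complex.norm_real, Real.norm_of_nonneg (expPhase_pos f ε y).le]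
    exact hf.expPhase_mono hε hy.1 hy.2 hx.2

/-- Monotonicity of ω gives ω(y)/ω(x) ≤ 1 under the integral. -/
theorem norm_weightedPrimitive_le {x : ℝ} (hx : x ∈ Ioo 0 Real.pi) :
    ‖weightedPrimitive f ε F x‖ ≤ ∫ y in (0 : ℝ)..x, ‖F y‖ := by
  have hpos := expPhase_pos f ε x
  rw [weightedPrimitive, norm_div, Complex.norm_real, Real.norm_of_nonneg hpos.le,
    div_le_iff₀ hpos, mul_comm, ← intervalIntegral.integral_const_mul]
  refine intervalIntegral.norm_integral_le_of_norm_le hx.1.le ?_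
    ((intervalIntegrable_left hF hx).norm.const_mul _)
  exact Eventually.of_forall fun y hy => hf.norm_expPhase_mul_le hε hx hy

theorem acLoc_weightedPrimitive : ACLoc (weightedPrimitive f ε F) (Ioo 0 Real.pi) := by
  intro a b hab hsub
  have h1 := acLoc_integral (fun x hx => hf.intervalIntegrable_expPhase_mul hε hF hx) a b hab hsub
  have h2 := hf.acLoc_inv_expPhase hε a b hab hsub
  refine (h1.fun_smul h2).congr fun x _ => ?_
  simp only [weightedPrimitive, smul_eq_mul, div_eq_mul_inv]

theorem ae_hasDerivAt_weightedPrimitive : ∀ᵐ x, x ∈ Ioo 0 Real.pi →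
    HasDerivAt (weightedPrimitive f ε F) (F x - weightedPrimitive f ε F x / (ε * f x)) x := by
  filter_upwards [ae_hasDerivAt_integral_Ioo
    (fun x hx => hf.intervalIntegrable_expPhase_mul hε hF hx)] with x h1 hx
  have h2 := (h1 hx).fun_div (hf.hasDerivAt_expPhase hε hx) (expPhase_ofReal_ne_zero f ε x)
  have h3 := expPhase_ofReal_ne_zero f ε x
  have h4 := hf.ofReal_ne_zero hx
  have h5 : (ε : ℂ) ≠ 0 := by exact_mod_cast hε.ne'
  refine h2.congr_deriv ?_
  unfold weightedPrimitive
  field_simp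

omit hf hε in
theorem acLoc_primitive : ACLoc (fun x => ∫ y in (0 : ℝ)..x, F y) (Ioo 0 Real.pi) :=
  acLoc_integral fun _ hx => intervalIntegrable_left hF hx

theorem acLoc_halfSolution : ACLoc (halfSolution f ε F) (Ioo 0 Real.pi) := fun a b hab hsub =>
  (acLoc_primitive hF a b hab hsub).fun_sub (hf.acLoc_weightedPrimitive hε hF a b hab hsub)

/-- Almost everywhere the two occurrences of F cancel. The remaining derivative is continuous, so it
is the derivative everywhere, although F itself is only integrable. -/
theorem hasDerivAt_halfSolution {x : ℝ} (hx : x ∈ Ioo 0 Real.pi) :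
    HasDerivAt (halfSolution f ε F) (weightedPrimitive f ε F x / (ε * f x)) x := by
  refine (hf.acLoc_halfSolution hε hF).hasDerivAt
    (hf.continuousOn_div_coefficient hε.ne' (hf.acLoc_weightedPrimitive hε hF).continuousOn) ?_ x hx
  filter_upwards [hf.ae_hasDerivAt_weightedPrimitive hε hF,
    ae_hasDerivAt_integral_Ioo fun x hx => intervalIntegrable_left hF hx] with x h1 h2 hx
  exact ((h2 hx).fun_sub (h1 hx)).congr_deriv (by ring)

theorem tendsto_halfSolution_zero : Tendsto (halfSolution f ε F) (𝓝[>] 0) (𝓝 0) := by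
  have h := tendsto_integral_right_zero Real.pi_pos hF
  have h2 := h.add h
  rw [add_zero] at h2
  refine squeeze_zero_norm' ?_ h2
  filter_upwards [Ioo_mem_nhdsGT Real.pi_pos] with x hx
  exact (norm_sub_le _ _).trans (add_le_add (norm_integral_zero_le hx.1.le)
    (hf.norm_weightedPrimitive_le hε hF hx))

omit hF in
theorem tendsto_expPhase_zero : Tendsto (fun x => (expPhase f ε x : ℂ)) (𝓝[>] 0) (𝓝 0) := by
  have h := Real.tendsto_exp_atBot.comp (hf.tendsto_phase_zero hε)
  have h2 := (Complex.continuous_ofReal.tendsto 0).comp h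
  rw [Complex.ofReal_zero] at h2
  refine h2.congr' ?_
  filter_upwards [self_mem_nhdsWithin] with x hx
  simp [expPhase_of_pos f ε (show 0 < x from hx)]

/-- For fixed y the factor ω(y)/ω(x) tends to 0 because ω blows up at π, and for y ≤ x it is at most
1: dominated convergence with majorant ‖F‖. -/
theorem tendsto_weightedPrimitive_pi :
    Tendsto (weightedPrimitive f ε F) (𝓝[<] Real.pi) (𝓝 0) := by
  have hpi := Real.pi_pos
  have hI : IntegrableOn F (Ioc 0 Real.pi) :=
    (intervalIntegrable_iff_integrableOn_Ioc_of_le hpi.le).mp hF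
  -- The indicator moves the variable endpoint into the integrand, as dominated convergence needs a
  -- fixed domain.
  have key : Tendsto (fun x => ∫ y in Ioc 0 Real.pi, (Iic x).indicator
      (fun y => (expPhase f ε y : ℂ) * F y / (expPhase f ε x : ℂ)) y) (𝓝[<] Real.pi)
      (𝓝 (∫ _ in Ioc 0 Real.pi, (0 : ℂ))) := by
    refine tendsto_integral_filter_of_dominated_convergence (fun y => ‖F y‖) ?_ ?_ hI.norm ?_
    · filter_upwards [Ioo_mem_nhdsLT hpi] with x hx
      have h1 := (hf.intervalIntegrable_expPhase_mul hε hF hx)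
      rw [intervalIntegrable_iff_integrableOn_Ioc_of_le hx.1.le] at h1
      have h2 := (h1.div_const (expPhase f ε x : ℂ)).aestronglyMeasurable
      rw [aestronglyMeasurable_indicator_iff measurableSet_Iic, Measure.restrict_restrict
        measurableSet_Iic]
      refine h2.mono_measure (Measure.restrict_mono ?_ le_rfl)
      exact fun y hy => ⟨hy.2.1, hy.1⟩
    · filter_upwards [Ioo_mem_nhdsLT hpi] with x hx
      filter_upwards [ae_restrict_mem measurableSet_Ioc] with y hy
      by_cases hyx : y ∈ Iic x
      · rw [indicator_of_mem hyx, norm_div, Complex.norm_real,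
          Real.norm_of_nonneg (expPhase_pos f ε x).le, div_le_iff₀ (expPhase_pos f ε x), mul_comm ‖F y‖]
        exact hf.norm_expPhase_mul_le hε hx ⟨hy.1, hyx⟩
      · rw [indicator_of_notMem hyx, norm_zero]
        exact norm_nonneg _
    · refine Eventually.of_forall fun y => ?_
      have h1 : Tendsto (fun x => ((Real.exp (-phase f ε x) : ℝ) : ℂ)) (𝓝[<] Real.pi) (𝓝 0) := by
        have h := (Real.tendsto_exp_neg_atTop_nhds_zero).comp (hf.tendsto_phase_pi hε)
        have h2 := (Complex.continuous_ofReal.tendsto 0).comp h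
        rwa [Complex.ofReal_zero] at h2
      have h2 := (h1.norm.const_mul ‖(expPhase f ε y : ℂ) * F y‖)
      rw [norm_zero, mul_zero] at h2
      refine squeeze_zero_norm' ?_ h2
      filter_upwards [Ioo_mem_nhdsLT hpi] with x hx
      refine (norm_indicator_le_norm_self _ _).trans (le_of_eq ?_)
      rw [div_eq_mul_inv, norm_mul, expPhase_of_pos f ε hx.1, Real.exp_neg, Complex.ofReal_inv]
  rw [integral_zero] at key
  refine key.congr' ?_
  filter_upwards [Ioo_mem_nhdsLT hpi] with x hx
  rw [weightedPrimitive, ← intervalIntegral.integral_div, intervalIntegral.integral_of_le hx.1.le,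
    setIntegral_indicator measurableSet_Iic]
  congr 2
  ext y
  exact ⟨fun h => ⟨h.1.1, h.2⟩, fun h => ⟨⟨h.1, h.2.trans hx.2.le⟩, h.2⟩⟩

theorem tendsto_halfSolution_pi :
    Tendsto (halfSolution f ε F) (𝓝[<] Real.pi) (𝓝 (∫ y in (0 : ℝ)..Real.pi, F y)) := by
  have hpi := Real.pi_pos
  have h := intervalIntegral.continuousOn_primitive_interval' hF left_mem_uIcc
  have h0 := h Real.pi right_mem_uIcc
  rw [ContinuousWithinAt, uIcc_of_le hpi.le] at h0
  have h1 := h0.mono_left (nhdsWithin_le_of_mem (Icc_mem_nhdsLT hpi))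
  have h2 := h1.sub (hf.tendsto_weightedPrimitive_pi hε hF)
  rwa [sub_zero] at h2

/-- A constant plus `halfSolution` is admissible on `(0, π)` and solves the equation there. -/
theorem acLoc_flux_halfSolution {v : ℝ → ℂ} {K : ℂ}
    (hv : ∀ x ∈ Ioo 0 Real.pi, v x = K + halfSolution f ε F x) :
    ACLoc (fun x => (f x : ℂ) * deriv v x + v x) (Ioo 0 Real.pi) ∧
      ∀ᵐ x, x ∈ Ioo 0 Real.pi → ell f ε v x = F x := by
  have hε0 : (ε : ℂ) ≠ 0 := by exact_mod_cast hε.ne'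
  have hder : ∀ x ∈ Ioo 0 Real.pi, deriv v x = weightedPrimitive f ε F x / (ε * f x) := by
    intro x hx
    refine HasDerivAt.deriv (((hf.hasDerivAt_halfSolution hε hF hx).const_add K
      ).congr_of_eventuallyEq ?_)
    filter_upwards [Ioo_mem_nhds hx.1 hx.2] with y hy using hv y hy
  have hflux : ∀ x ∈ Ioo 0 Real.pi,
      (f x : ℂ) * deriv v x = (ε : ℂ)⁻¹ * weightedPrimitive f ε F x := fun x hx => by
    have := hf.ofReal_ne_zero hx
    rw [hder x hx]; field_simp
  constructor
  · have h1 : ACLoc (fun x => (ε : ℂ)⁻¹ • weightedPrimitive f ε F x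
        + (K + halfSolution f ε F x)) (Ioo 0 Real.pi) := fun a b hab hsub =>
      ((hf.acLoc_weightedPrimitive hε hF a b hab hsub).const_smul _).fun_add
        ((AbsolutelyContinuousOnInterval.const K a b).fun_add
          (hf.acLoc_halfSolution hε hF a b hab hsub))
    refine h1.of_eqOn fun x hx => ?_
    simp only [hflux x hx, hv x hx, smul_eq_mul]
  · filter_upwards [hf.ae_hasDerivAt_weightedPrimitive hε hF] with x h1 hx
    have h2 : deriv (fun t => (f t : ℂ) * deriv v t) x
        = (ε : ℂ)⁻¹ * (F x - weightedPrimitive f ε F x / (ε * f x)) := by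
      refine HasDerivAt.deriv (((h1 hx).const_mul _).congr_of_eventuallyEq ?_)
      filter_upwards [Ioo_mem_nhds hx.1 hx.2] with y hy using hflux y hy
    rw [ell, h2, hder x hx, mul_inv_cancel_left₀ hε0]
    ring

/-- Solutions on `(0, π)` that have a limit at `0` are given by `halfSolution`. -/
theorem eq_add_halfSolution {v : ℝ → ℂ} {K : ℂ} (hv : ACLoc v (Ioo 0 Real.pi))
    (hflux : ACLoc (fun x => (f x : ℂ) * deriv v x + v x) (Ioo 0 Real.pi))
    (hell : ∀ᵐ x, x ∈ Ioo 0 Real.pi → ell f ε v x = F x) (hK : Tendsto v (𝓝[>] 0) (𝓝 K)) :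
    ∀ x ∈ Ioo 0 Real.pi, v x = K + halfSolution f ε F x := by
  have hpi := Real.pi_pos
  have hε0 : (ε : ℂ) ≠ 0 := by exact_mod_cast hε.ne'
  have hmid : Real.pi / 2 ∈ Ioo 0 Real.pi := ⟨by linarith, by linarith⟩
  have hD : ACLoc (fun x => (f x : ℂ) * deriv v x) (Ioo 0 Real.pi) := fun a b hab hsub =>
    ((hflux a b hab hsub).fun_sub (hv a b hab hsub)).congr fun x _ => by simp
  have hW : ACLoc (fun x => (ε : ℂ) • ((f x : ℂ) * deriv v x) + v x - ∫ y in (0 : ℝ)..x, F y)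
      (Ioo 0 Real.pi) := fun a b hab hsub =>
    (((hD a b hab hsub).const_smul (ε : ℂ)).fun_add (hv a b hab hsub)).fun_sub
      (acLoc_primitive hF a b hab hsub)
  -- First integral: the derivative of ε f v' + v - ∫F is `ell f ε v` - F, zero almost everywhere.
  -- Local absolute continuity then makes the expression constant.
  have hWd : ∀ x ∈ Ioo 0 Real.pi, HasDerivAt
      (fun x => (ε : ℂ) • ((f x : ℂ) * deriv v x) + v x - ∫ y in (0 : ℝ)..x, F y) 0 x := by
    refine hW.hasDerivAt continuousOn_const ?_
    filter_upwards [hD.ae_differentiableAt, hv.ae_differentiableAt, hell,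
      ae_hasDerivAt_integral_Ioo fun x hx => intervalIntegrable_left hF hx] with x h1 h2 h3 h4 hx
    refine ((((h1 hx).hasDerivAt.const_smul (ε : ℂ)).fun_add (h2 hx).hasDerivAt).fun_sub
      (h4 hx)).congr_deriv ?_
    rw [← h3 hx, ell, smul_eq_mul, sub_self]
  obtain ⟨K₀, hK₀⟩ := isOpen_Ioo.exists_is_const_of_deriv_eq_zero isPreconnected_Ioo
    (fun x hx => (hWd x hx).differentiableAt.differentiableWithinAt)
    (fun x hx => (hWd x hx).deriv)
  have hder : ∀ x ∈ Ioo 0 Real.pi,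
      deriv v x = (K₀ + (∫ y in (0 : ℝ)..x, F y) - v x) / (ε * f x) := fun x hx => by
    have h1 := hK₀ x hx
    have h2 := hf.ofReal_ne_zero hx
    simp only [smul_eq_mul] at h1
    rw [eq_div_iff (mul_ne_zero hε0 h2), ← h1]
    ring
  have hvd : ∀ x ∈ Ioo 0 Real.pi,
      HasDerivAt v ((K₀ + (∫ y in (0 : ℝ)..x, F y) - v x) / (ε * f x)) x := by
    refine hv.hasDerivAt (hf.continuousOn_div_coefficient hε.ne'
      ((continuousOn_const.add (acLoc_primitive hF).continuousOn).sub hv.continuousOn)) ?_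
    filter_upwards [hv.ae_differentiableAt] with x h1 hx
    rw [← hder x hx]
    exact (h1 hx).hasDerivAt
  -- Two solutions with the same first integral differ by a multiple of 1/ω, so the difference times
  -- ω is constant.
  have hYd : ∀ x ∈ Ioo 0 Real.pi, HasDerivAt
      (fun x => (expPhase f ε x : ℂ) * (v x - (K₀ + halfSolution f ε F x))) 0 x := fun x hx => by
    refine ((hf.hasDerivAt_expPhase hε hx).fun_mul ((hvd x hx).fun_sub
      ((hf.hasDerivAt_halfSolution hε hF hx).const_add K₀))).congr_deriv ?_
    have h2 := hf.ofReal_ne_zero hx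
    rw [halfSolution]
    field_simp
    ring
  obtain ⟨k, hk⟩ := isOpen_Ioo.exists_is_const_of_deriv_eq_zero isPreconnected_Ioo
    (fun x hx => (hYd x hx).differentiableAt.differentiableWithinAt)
    (fun x hx => (hYd x hx).deriv)
  have hsol0 := hf.tendsto_halfSolution_zero hε hF
  have hlim : Tendsto (fun x => (expPhase f ε x : ℂ) * (v x - (K₀ + halfSolution f ε F x)))
      (𝓝[>] 0) (𝓝 (0 * (K - (K₀ + 0)))) :=
    (hf.tendsto_expPhase_zero hε).mul (hK.sub (tendsto_const_nhds.add hsol0))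
  have hev : ∀ᶠ x in 𝓝[>] (0 : ℝ), x ∈ Ioo 0 Real.pi := Ioo_mem_nhdsGT hpi
  -- As x → 0 the bracket stays bounded and ω → 0: the singular solution 1/ω is ruled out by the
  -- limit of v at 0.
  have hk0 : k = 0 := by
    rw [zero_mul] at hlim
    refine tendsto_nhds_unique (tendsto_const_nhds.congr' ?_) hlim
    filter_upwards [hev] with x hx using (hk x hx).symm
  have hv0 : ∀ x ∈ Ioo 0 Real.pi, v x = K₀ + halfSolution f ε F x := fun x hx => by
    have h1 := hk x hx
    simp only [hk0] at h1
    exact sub_eq_zero.mp ((mul_eq_zero.mp h1).resolve_left (expPhase_ofReal_ne_zero f ε x))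
  have hKK : K = K₀ := by
    have h1 : Tendsto (fun x => K₀ + halfSolution f ε F x) (𝓝[>] 0) (𝓝 (K₀ + 0)) :=
      tendsto_const_nhds.add hsol0
    rw [add_zero] at h1
    refine tendsto_nhds_unique hK (h1.congr' ?_)
    filter_upwards [hev] with x hx using (hv0 x hx).symm
  rw [hKK]
  exact hv0

/-- The derivative of `halfSolution` is integrable at `0` if `F` is square integrable. -/
theorem intervalIntegrable_deriv_halfSolution {B : ℝ}
    (hB : ∀ x ∈ Ioo 0 Real.pi, ∫ y in (0 : ℝ)..x, ‖F y‖ ≤ B * Real.sqrt x) {b : ℝ}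
    (hb : b ∈ Ioo 0 Real.pi) :
    IntervalIntegrable (fun x => weightedPrimitive f ε F x / (ε * f x)) volume 0 b := by
  obtain ⟨m, _, hm, -, hbd⟩ := hf.exists_linear_bounds
  have hpi := Real.pi_pos
  have hcont := hf.continuousOn_div_coefficient hε.ne'
    (hf.acLoc_weightedPrimitive hε hF).continuousOn
  have hmid : Real.pi / 2 ∈ Ioo 0 Real.pi := ⟨by linarith, by linarith⟩
  have h1 : IntervalIntegrable (fun x => weightedPrimitive f ε F x / (ε * f x)) volume 0
      (Real.pi / 2) := by
    -- The numerator is at most B √x and f(x) ≥ m x, so x^(-1/2) is an integrable majorant.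
    have hr : IntervalIntegrable (fun x : ℝ => B / (ε * m) * x ^ (-(1 / 2) : ℝ)) volume 0
        (Real.pi / 2) := (intervalIntegral.intervalIntegrable_rpow' (by norm_num)).const_mul _
    refine hr.mono_fun ?_ ?_
    · rw [uIoc_of_le (by linarith)]
      exact (hcont.mono fun x hx => ⟨hx.1, hx.2.trans_lt hmid.2⟩).aestronglyMeasurable
        measurableSet_Ioc
    · rw [uIoc_of_le (by linarith)]
      filter_upwards [ae_restrict_mem measurableSet_Ioc] with x hx
      have hxI : x ∈ Ioo 0 Real.pi := ⟨hx.1, hx.2.trans_lt hmid.2⟩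
      have e1 := (hf.norm_weightedPrimitive_le hε hF hxI).trans (hB x hxI)
      have e2 := (hbd x hx).1
      have hs : 0 < Real.sqrt x := Real.sqrt_pos.mpr hx.1
      have hB0 : 0 ≤ B := by
        have : 0 ≤ B * Real.sqrt x := (norm_nonneg _).trans e1
        exact nonneg_of_mul_nonneg_left this hs
      have hx12 : x ^ (-(1 / 2) : ℝ) = Real.sqrt x / x := by
        rw [Real.rpow_neg hx.1.le, ← Real.sqrt_eq_rpow, inv_eq_one_div,
          div_eq_div_iff hs.ne' hx.1.ne', one_mul, Real.mul_self_sqrt hx.1.le]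
      have hnorm : ‖((ε : ℂ) * (f x : ℂ))‖ = ε * f x := by
        rw [← Complex.ofReal_mul, Complex.norm_real,
          Real.norm_of_nonneg (mul_pos hε (hf.pos x hxI)).le]
      rw [norm_div, hnorm, hx12, Real.norm_of_nonneg (by positivity [hx.1])]
      calc ‖weightedPrimitive f ε F x‖ / (ε * f x) ≤ B * Real.sqrt x / (ε * (m * x)) := by
            have := hx.1
            gcongr
        _ = B / (ε * m) * (Real.sqrt x / x) := by
            have := hx.1.ne'
            field_simp
  refine h1.trans (ContinuousOn.intervalIntegrable (hcont.mono ?_))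
  exact ordConnected_Ioo.uIcc_subset hmid hb

end Coefficient

/-! ### Reflection and the equation on (-π, π) -/

/-- The image of a right-hand side under the symmetry `x ↦ -x` of the equation. -/
def reflection (F : ℝ → ℂ) (y : ℝ) : ℂ := -F (-y)

/-- The function represented by the integral operator applied to `F`. -/
noncomputable def greenIntegral (f : ℝ → ℝ) (ε : ℝ) (F : ℝ → ℂ) (x : ℝ) : ℂ :=
  ∫ y, phaseKernel f ε x y * F y ∂circMeasure

theorem integral_circMeasure (F : ℝ → ℂ) :
    ∫ y, F y ∂circMeasure = ∫ y in (-Real.pi)..Real.pi, F y := by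
  rw [intervalIntegral.integral_of_le (by linarith [Real.pi_pos]), integral_Ioc_eq_integral_Ioo]

theorem integrable_circMeasure_iff {E : Type*} [NormedAddCommGroup E] {F : ℝ → E} :
    Integrable F circMeasure ↔ IntervalIntegrable F volume (-Real.pi) Real.pi := by
  rw [intervalIntegrable_iff_integrableOn_Ioo_of_le (by linarith [Real.pi_pos])]
  rfl

theorem integral_circMeasure_comp_neg (F : ℝ → ℂ) :
    ∫ y, F (-y) ∂circMeasure = ∫ y, F y ∂circMeasure := by
  rw [integral_circMeasure, integral_circMeasure, intervalIntegral.integral_comp_neg, neg_neg]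

theorem integrable_circMeasure_comp_neg {E : Type*} [NormedAddCommGroup E] {F : ℝ → E}
    (hF : Integrable F circMeasure) : Integrable (fun y => F (-y)) circMeasure := by
  rw [integrable_circMeasure_iff] at hF ⊢
  have h := hF.comp_mul_left (c := -1)
  simpa [div_neg] using h.symm

theorem integrable_reflection {F : ℝ → ℂ} (hF : Integrable F circMeasure) :
    Integrable (reflection F) circMeasure := (integrable_circMeasure_comp_neg hF).neg

theorem intervalIntegrable_zero_pi {E : Type*} [NormedAddCommGroup E] {F : ℝ → E}
    (hF : Integrable F circMeasure) : IntervalIntegrable F volume 0 Real.pi := by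
  have hpi := Real.pi_pos
  refine (integrable_circMeasure_iff.mp hF).mono_set ?_
  rw [uIcc_of_le hpi.le, uIcc_of_le (by linarith)]
  exact Icc_subset_Icc_left (by linarith)

/-- Cauchy–Schwarz on (0, x), whose measure is x. The factor √x is what makes u' integrable across
the singularity. -/
theorem exists_integral_norm_le_mul_sqrt {F : ℝ → ℂ} (hF : Integrable F circMeasure)
    (hF2 : Integrable (fun y => ‖F y‖ ^ 2) circMeasure) :
    ∃ B : ℝ, ∀ x ∈ Ioo 0 Real.pi, ∫ y in (0 : ℝ)..x, ‖F y‖ ≤ B * Real.sqrt x := by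
  refine ⟨Real.sqrt (∫ y, ‖F y‖ ^ 2 ∂circMeasure), fun x hx => ?_⟩
  have hsub : Ioo 0 x ⊆ Ioo (-Real.pi) Real.pi :=
    Ioo_subset_Ioo (by linarith [Real.pi_pos]) hx.2.le
  have h1 := sq_integral_norm_le (μ := volume.restrict (Ioo 0 x))
    (hF.mono_measure (Measure.restrict_mono hsub le_rfl))
    (hF2.mono_measure (Measure.restrict_mono hsub le_rfl))
  have h2 : ∫ y in Ioo 0 x, ‖F y‖ ^ 2 ≤ ∫ y, ‖F y‖ ^ 2 ∂circMeasure :=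
    setIntegral_mono_set hF2 (Eventually.of_forall fun _ => by positivity) hsub.eventuallyLE
  have h3 : (volume.restrict (Ioo 0 x)).real univ = x := by
    rw [measureReal_restrict_apply_univ, Real.volume_real_Ioo_of_le hx.1.le, sub_zero]
  rw [intervalIntegral.integral_of_le hx.1.le, integral_Ioc_eq_integral_Ioo,
    ← Real.sqrt_mul (integral_nonneg fun _ => by positivity)]
  refine Real.le_sqrt_of_sq_le (h1.trans ?_)
  rw [h3, mul_comm]
  exact mul_le_mul_of_nonneg_right h2 hx.1.le

theorem ACLoc.union_symm {v : ℝ → ℂ} {r : ℝ} (h1 : ACLoc v (Ioo (-r) 0)) (h2 : ACLoc v (Ioo 0 r)) :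
    ACLoc v (Ioo (-r) 0 ∪ Ioo 0 r) := by
  intro a b hab hsub
  rcases lt_or_ge b 0 with hb | hb
  · refine h1 a b hab fun x hx => (hsub hx).resolve_right fun h => ?_
    linarith [h.1, hx.2]
  rcases lt_or_ge 0 a with ha | ha
  · refine h2 a b hab fun x hx => (hsub hx).resolve_left fun h => ?_
    linarith [h.2, hx.1]
  · rcases hsub (show (0 : ℝ) ∈ Icc a b from ⟨ha, hb⟩) with h | h
    · exact absurd h.2 (lt_irrefl _)
    · exact absurd h.1 (lt_irrefl _)

theorem ACLoc.comp_neg_Ioo {v : ℝ → ℂ} {a b : ℝ} (h : ACLoc v (Ioo a b)) :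
    ACLoc (fun x => v (-x)) (Ioo (-b) (-a)) :=
  h.comp_neg.mono fun x hx => show -x ∈ Ioo a b from ⟨by linarith [hx.2], by linarith [hx.1]⟩

theorem ae_comp_neg {P : ℝ → Prop} (h : ∀ᵐ x : ℝ, P x) : ∀ᵐ x : ℝ, P (-x) :=
  (Measure.measurePreserving_neg (volume : Measure ℝ)).quasiMeasurePreserving.ae h

theorem tendsto_neg_nhdsGT_neg (a : ℝ) : Tendsto (fun x : ℝ => -x) (𝓝[>] (-a)) (𝓝[<] a) := by
  simpa using tendsto_neg_nhdsGT (a := -a)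

theorem tendsto_neg_nhdsLT_zero : Tendsto (fun x : ℝ => -x) (𝓝[<] 0) (𝓝[>] 0) := by
  simpa using tendsto_neg_nhdsLT (a := (0 : ℝ))

theorem tendsto_neg_nhdsGT_zero : Tendsto (fun x : ℝ => -x) (𝓝[>] 0) (𝓝[<] 0) := by
  simpa using tendsto_neg_nhdsGT (a := (0 : ℝ))

/-- The two terms are the increments of a solution from 0 to π and from 0 to -π, so the periodic
boundary condition becomes the vanishing of the mean. -/
theorem integral_circMeasure_eq (F : ℝ → ℂ) (hF : Integrable F circMeasure) :
    ∫ y, F y ∂circMeasure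
      = (∫ y in (0 : ℝ)..Real.pi, F y) - ∫ y in (0 : ℝ)..Real.pi, reflection F y := by
  have h1 : IntervalIntegrable F volume (-Real.pi) 0 := by
    refine (integrable_circMeasure_iff.mp hF).mono_set ?_
    rw [uIcc_of_le (by linarith [Real.pi_pos]), uIcc_of_le (by linarith [Real.pi_pos])]
    exact Icc_subset_Icc_right Real.pi_pos.le
  rw [integral_circMeasure, ← intervalIntegral.integral_add_adjacent_intervals h1 (intervalIntegrable_zero_pi hF)]
  have h2 := intervalIntegral.integral_comp_neg (a := 0) (b := Real.pi) F
  rw [neg_zero] at h2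
  simp only [reflection, intervalIntegral.integral_neg, h2]
  ring

namespace Coefficient

variable {f : ℝ → ℝ} (hf : Coefficient f) {ε : ℝ}
include hf

theorem flux_comp_neg (v : ℝ → ℂ) (x : ℝ) :
    (f x : ℂ) * deriv (fun t => v (-t)) x = (f (-x) : ℂ) * deriv v (-x) := by
  rw [deriv_comp_neg, hf.odd]
  push_cast; ring

/-- Oddness of f makes the flux f u' invariant under reflection, and one more derivative changes the
sign. The left half interval thus becomes the right one with right-hand side `reflection F`. -/
theorem ell_comp_neg (v : ℝ → ℂ) (x : ℝ) :
    ell f ε (fun t => v (-t)) x = -ell f ε v (-x) := by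
  have h1 : (fun t => (f t : ℂ) * deriv (fun t => v (-t)) t)
      = fun t => (fun s => (f s : ℂ) * deriv v s) (-t) := funext fun t => hf.flux_comp_neg v t
  rw [ell, h1, deriv_comp_neg (fun s => (f s : ℂ) * deriv v s), deriv_comp_neg, ell]
  ring

variable (hε : 0 < ε)
include hε

theorem integral_halfKernel {F : ℝ → ℂ} (hF : IntervalIntegrable F volume 0 Real.pi) {x : ℝ}
    (hx : x ∈ Ioo 0 Real.pi) :
    ∫ y, (halfKernel f ε (x, y) : ℂ) * F y ∂circMeasure = halfSolution f ε F x := by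
  have h1 : ∀ y, (halfKernel f ε (x, y) : ℂ) * F y
      = (Ioo 0 x).indicator (fun y => F y - (expPhase f ε y : ℂ) * F y / (expPhase f ε x : ℂ)) y := by
    intro y
    by_cases hy : y ∈ Ioo 0 x
    · rw [halfKernel, indicator_of_mem (show (x, y) ∈ upperTriangle from ⟨hy.1, hy.2, hx.2⟩),
        indicator_of_mem hy]
      push_cast; ring
    · rw [halfKernel, indicator_of_notMem (show (x, y) ∉ upperTriangle from
        fun h => hy ⟨h.1, h.2.1⟩), indicator_of_notMem hy]
      simp
  have hsub : Ioo 0 x ⊆ Ioo (-Real.pi) Real.pi :=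
    Ioo_subset_Ioo (by linarith [Real.pi_pos]) hx.2.le
  simp_rw [h1]
  rw [setIntegral_indicator measurableSet_Ioo, inter_eq_right.mpr hsub,
    ← integral_Ioc_eq_integral_Ioo, ← intervalIntegral.integral_of_le hx.1.le,
    intervalIntegral.integral_sub (intervalIntegrable_left hF hx)
      ((hf.intervalIntegrable_expPhase_mul hε hF hx).div_const _),
    intervalIntegral.integral_div]
  rfl

theorem greenIntegral_of_pos {F : ℝ → ℂ} (hF : Integrable F circMeasure) {x : ℝ}
    (hx : x ∈ Ioo 0 Real.pi) : greenIntegral f ε F x = halfSolution f ε F x := by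
  rw [← hf.integral_halfKernel hε (intervalIntegrable_zero_pi hF) hx, greenIntegral]
  refine integral_congr_ae (Eventually.of_forall fun y => ?_)
  have : (-x, -y) ∉ upperTriangle := fun h => by linarith [h.1, h.2.1, hx.1]
  simp only [phaseKernel]
  rw [show halfKernel f ε (-x, -y) = 0 from indicator_of_notMem this _, sub_zero]

omit hf hε in
theorem greenIntegral_neg (F : ℝ → ℂ) (x : ℝ) :
    greenIntegral f ε F (-x) = greenIntegral f ε (reflection F) x := by
  rw [greenIntegral, ← integral_circMeasure_comp_neg, greenIntegral]
  refine integral_congr_ae (Eventually.of_forall fun y => ?_)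
  simp only [phaseKernel, reflection, neg_neg]
  push_cast
  ring

omit hf hε in
theorem greenIntegral_zero (F : ℝ → ℂ) : greenIntegral f ε F 0 = 0 := by
  rw [greenIntegral, ← integral_zero ℝ ℂ]
  refine integral_congr_ae (Eventually.of_forall fun y => ?_)
  have h1 : ((0 : ℝ), y) ∉ upperTriangle := fun h => by linarith [h.1, h.2.1]
  have h2 : (-(0 : ℝ), -y) ∉ upperTriangle := fun h => by
    rw [neg_zero] at h; linarith [h.1, h.2.1]
  simp only [phaseKernel]
  rw [show halfKernel f ε (0, y) = 0 from indicator_of_notMem h1 _,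
    show halfKernel f ε (-0, -y) = 0 from indicator_of_notMem h2 _]
  simp

/-- Functions in the domain are a constant plus the integral operator of their image, and their
image has mean zero. -/
theorem eq_add_greenIntegral {v F : ℝ → ℂ} (hF : Integrable F circMeasure) (hadm : Admissible f v)
    (hv : ACLoc v (Ioo (-Real.pi) Real.pi)) (hell : ∀ᵐ x ∂circMeasure, ell f ε v x = F x) {l : ℂ}
    (hl : Tendsto v (𝓝[<] Real.pi) (𝓝 l)) (hl' : Tendsto v (𝓝[>] (-Real.pi)) (𝓝 l)) :
    (∀ x ∈ Ioo (-Real.pi) Real.pi, v x = v 0 + greenIntegral f ε F x) ∧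
      ∫ y, F y ∂circMeasure = 0 := by
  have hpi := Real.pi_pos
  have hcont : ContinuousAt v 0 :=
    hv.continuousOn.continuousAt (Ioo_mem_nhds (by linarith) hpi)
  have hell' := (ae_restrict_iff' measurableSet_Ioo).mp hell
  have hF' : Integrable (reflection F) circMeasure := integrable_reflection hF
  have hpos := hf.eq_add_halfSolution hε (intervalIntegrable_zero_pi hF) (hadm.1.mono subset_union_right)
    (hadm.2.mono subset_union_right)
    (by filter_upwards [hell'] with x hx hx0 using hx ⟨by linarith [hx0.1], hx0.2⟩)
    (hcont.tendsto.mono_left nhdsWithin_le_nhds)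
  have hneg := hf.eq_add_halfSolution hε (intervalIntegrable_zero_pi hF') (v := fun x => v (-x)) (K := v 0)
    (by simpa using (hadm.1.mono (subset_union_left (s := Ioo (-Real.pi) 0))).comp_neg_Ioo)
    (by
      simp only [hf.flux_comp_neg]
      simpa using (hadm.2.mono (subset_union_left (s := Ioo (-Real.pi) 0))).comp_neg_Ioo)
    (by
      filter_upwards [ae_comp_neg hell'] with x hx hx0
      rw [hf.ell_comp_neg, hx ⟨by linarith [hx0.2], by linarith [hx0.1]⟩]
      rfl)
    ((hcont.tendsto.mono_left nhdsWithin_le_nhds).comp tendsto_neg_nhdsGT_zero)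
  constructor
  · intro x hx
    rcases lt_trichotomy x 0 with h | h | h
    · have hx' : -x ∈ Ioo 0 Real.pi := ⟨by linarith, by linarith [hx.1]⟩
      have h1 := hneg (-x) hx'
      simp only [neg_neg] at h1
      rw [h1, ← hf.greenIntegral_of_pos hε hF' hx', ← greenIntegral_neg, neg_neg]
    · rw [h, greenIntegral_zero, add_zero]
    · rw [hpos x ⟨h, hx.2⟩, hf.greenIntegral_of_pos hε hF ⟨h, hx.2⟩]
  · have hev : ∀ᶠ x in 𝓝[<] Real.pi, x ∈ Ioo 0 Real.pi := Ioo_mem_nhdsLT hpi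
    -- The common limit is computed from the right half here and from the left half below; equating
    -- the two gives mean zero.
    have e1 : l = v 0 + ∫ y in (0 : ℝ)..Real.pi, F y := by
      refine tendsto_nhds_unique hl
        (((hf.tendsto_halfSolution_pi hε (intervalIntegrable_zero_pi hF)).const_add (v 0)).congr' ?_)
      filter_upwards [hev] with x hx using (hpos x hx).symm
    have e2 : l = v 0 + ∫ y in (0 : ℝ)..Real.pi, reflection F y := by
      refine tendsto_nhds_unique (hl'.comp tendsto_neg_nhdsLT)
        (((hf.tendsto_halfSolution_pi hε (intervalIntegrable_zero_pi hF')).const_add (v 0)).congr' ?_)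
      filter_upwards [hev] with x hx using (hneg x hx).symm
    rw [integral_circMeasure_eq F hF, sub_eq_zero]
    exact add_left_cancel (e1.symm.trans e2)

/-- A constant plus the integral operator of a function of mean zero lies in the domain. -/
theorem isSolution_add_greenIntegral {F : ℝ → ℂ} (hF : Integrable F circMeasure)
    (hF2 : Integrable (fun y => ‖F y‖ ^ 2) circMeasure) (hF0 : ∫ y, F y ∂circMeasure = 0)
    {v : ℝ → ℂ} {K : ℂ} (hv : v = fun x => K + greenIntegral f ε F x) :
    Admissible f v ∧ ACLoc v (Ioo (-Real.pi) Real.pi) ∧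
      (∀ᵐ x ∂circMeasure, ell f ε v x = F x) ∧
      ∃ l : ℂ, Tendsto v (𝓝[<] Real.pi) (𝓝 l) ∧ Tendsto v (𝓝[>] (-Real.pi)) (𝓝 l) := by
  have hpi := Real.pi_pos
  have hF' : Integrable (reflection F) circMeasure := integrable_reflection hF
  have hF2' : Integrable (fun y => ‖reflection F y‖ ^ 2) circMeasure := by
    simpa only [reflection, norm_neg] using integrable_circMeasure_comp_neg hF2
  have hpos : ∀ x ∈ Ioo 0 Real.pi, v x = K + halfSolution f ε F x := fun x hx => by
    rw [hv, ← hf.greenIntegral_of_pos hε hF hx]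
  set w : ℝ → ℂ := fun x => v (-x) with hw
  have hneg : ∀ x ∈ Ioo 0 Real.pi, w x = K + halfSolution f ε (reflection F) x := fun x hx => by
    rw [hw, hv, ← hf.greenIntegral_of_pos hε hF' hx, ← greenIntegral_neg]
  have hvw : v = fun x => w (-x) := by funext x; simp [hw]
  have hac : ACLoc v (Ioo 0 Real.pi) :=
    ACLoc.of_eqOn (fun a b hab hsub => (AbsolutelyContinuousOnInterval.const K a b).fun_add
      (hf.acLoc_halfSolution hε (intervalIntegrable_zero_pi hF) a b hab hsub)) fun x hx => (hpos x hx).symm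
  have hac' : ACLoc w (Ioo 0 Real.pi) :=
    ACLoc.of_eqOn (fun a b hab hsub => (AbsolutelyContinuousOnInterval.const K a b).fun_add
      (hf.acLoc_halfSolution hε (intervalIntegrable_zero_pi hF') a b hab hsub)) fun x hx => (hneg x hx).symm
  obtain ⟨hfl, hel⟩ := hf.acLoc_flux_halfSolution hε (intervalIntegrable_zero_pi hF) hpos
  obtain ⟨hfl', hel'⟩ := hf.acLoc_flux_halfSolution hε (intervalIntegrable_zero_pi hF') hneg
  refine ⟨⟨ACLoc.union_symm ?_ hac, ACLoc.union_symm ?_ hfl⟩, ?_, ?_, ?_⟩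
  · rw [hvw]
    simpa using hac'.comp_neg_Ioo
  · have h1 : (fun x => (f x : ℂ) * deriv v x + v x)
        = fun x => (fun s => (f s : ℂ) * deriv w s + w s) (-x) := by
      funext x
      have := hf.flux_comp_neg w x
      rw [← hvw] at this
      rw [this]
      simp [hw]
    rw [h1]
    simpa using hfl'.comp_neg_Ioo
  -- Absolute continuity across 0: v is continuous at 0, differentiable elsewhere, and its
  -- derivative is integrable near 0, so the fundamental theorem holds with the single exceptional
  -- point 0.
  · have hd : ∀ x ∈ Ioo 0 Real.pi,
        HasDerivAt v (weightedPrimitive f ε F x / (ε * f x)) x := fun x hx => by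
      refine ((hf.hasDerivAt_halfSolution hε (intervalIntegrable_zero_pi hF) hx).const_add K).congr_of_eventuallyEq ?_
      filter_upwards [Ioo_mem_nhds hx.1 hx.2] with y hy using hpos y hy
    have hd' : ∀ x ∈ Ioo 0 Real.pi,
        HasDerivAt w (weightedPrimitive f ε (reflection F) x / (ε * f x)) x := fun x hx => by
      refine ((hf.hasDerivAt_halfSolution hε (intervalIntegrable_zero_pi hF') hx).const_add K).congr_of_eventuallyEq ?_
      filter_upwards [Ioo_mem_nhds hx.1 hx.2] with y hy using hneg y hy
    set g : ℝ → ℂ := fun x => if 0 < x then weightedPrimitive f ε F x / (ε * f x)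
      else -(fun t => weightedPrimitive f ε (reflection F) t / (ε * f t)) (-x) with hg
    have hdv : ∀ x ∈ Ioo (-Real.pi) Real.pi, x ≠ 0 → HasDerivAt v (g x) x := by
      intro x hx hx0
      rcases lt_or_gt_of_ne hx0 with h | h
      · have h1 := (hd' (-x) ⟨by linarith, by linarith [hx.1]⟩).scomp x (hasDerivAt_neg x)
        rw [show w ∘ Neg.neg = v by rw [hvw]; rfl] at h1
        refine h1.congr_deriv ?_
        simp only [hg, if_neg (not_lt.mpr h.le), neg_smul, one_smul]
      · refine (hd x ⟨h, hx.2⟩).congr_deriv ?_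
        simp only [hg, if_pos h]
    have hev : ∀ᶠ x in 𝓝[>] (0 : ℝ), x ∈ Ioo 0 Real.pi := Ioo_mem_nhdsGT hpi
    have hv0 : v 0 = K := by rw [hv]; simp [greenIntegral_zero]
    have hcont0 : ContinuousAt v 0 := by
      rw [continuousAt_iff_continuous_left'_right']
      have t1 := (hf.tendsto_halfSolution_zero hε (intervalIntegrable_zero_pi hF)).const_add K
      have t2 := (hf.tendsto_halfSolution_zero hε (intervalIntegrable_zero_pi hF')).const_add K
      rw [add_zero] at t1 t2
      have t3 : Tendsto w (𝓝[>] 0) (𝓝 K) := t2.congr' (by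
        filter_upwards [hev] with x hx using (hneg x hx).symm)
      constructor
      · rw [ContinuousWithinAt, hv0, hvw]
        exact t3.comp tendsto_neg_nhdsLT_zero
      · rw [ContinuousWithinAt, hv0]
        refine t1.congr' ?_
        filter_upwards [hev] with x hx using (hpos x hx).symm
    obtain ⟨B, hB⟩ := exists_integral_norm_le_mul_sqrt hF hF2
    obtain ⟨B', hB'⟩ := exists_integral_norm_le_mul_sqrt hF' hF2'
    intro a b hab hsub
    have ha := hsub (left_mem_Icc.mpr hab)
    have hb := hsub (right_mem_Icc.mpr hab)
    -- Enlarging [a, b] to a symmetric interval [-d, d] around 0 spares a distinction by the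
    -- position of 0.
    obtain ⟨d, hd1, hd2⟩ := exists_between
      (max_lt (max_lt (abs_lt.mpr ha) (abs_lt.mpr hb)) hpi)
    have hd0 : 0 < d := (le_max_right _ _).trans_lt hd1
    have hda := abs_lt.mp (((le_max_left _ _).trans (le_max_left _ _)).trans_lt hd1)
    have hdb := abs_lt.mp (((le_max_right _ _).trans (le_max_left _ _)).trans_lt hd1)
    have hdI : d ∈ Ioo 0 Real.pi := ⟨hd0, hd2⟩
    have hdd : uIcc (-d) d ⊆ Ioo (-Real.pi) Real.pi := by
      rw [uIcc_of_le (by linarith)]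
      exact fun x hx => ⟨by linarith [hx.1], by linarith [hx.2]⟩
    have hcont : ContinuousOn v (uIcc (-d) d) := fun x hx => by
      by_cases hx0 : x = 0
      · rw [hx0]; exact hcont0.continuousWithinAt
      · exact (hdv x (hdd hx) hx0).continuousAt.continuousWithinAt
    have hi1 : IntervalIntegrable g volume 0 d := by
      refine (hf.intervalIntegrable_deriv_halfSolution hε (intervalIntegrable_zero_pi hF) hB hdI).congr fun x hx => ?_
      rw [uIoc_of_le hd0.le] at hx
      simp only [hg, if_pos hx.1]
    have hi2 : IntervalIntegrable g volume (-d) 0 := by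
      have h1 := hf.intervalIntegrable_deriv_halfSolution hε (intervalIntegrable_zero_pi hF') hB' hdI
      have h2 := (h1.comp_mul_left (c := -1)).symm
      simp only [neg_mul, one_mul, div_neg, div_one, neg_zero] at h2
      refine h2.neg.congr fun x hx => ?_
      rw [uIoc_of_le (by linarith)] at hx
      simp only [hg, if_neg (not_lt.mpr hx.2), Pi.neg_apply]
    refine (AbsolutelyContinuousOnInterval.of_hasDerivAt (countable_singleton (0 : ℝ)) hcont
      (fun x hx => hdv x (hdd hx.1) hx.2) (hi2.trans hi1)).mono ?_
    rw [uIcc_of_le hab, uIcc_of_le (by linarith)]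
    exact Icc_subset_Icc hda.1.le hdb.2.le
  · rw [ae_restrict_iff' measurableSet_Ioo]
    have h0 : ∀ᵐ x : ℝ, x ≠ 0 := compl_mem_ae_iff.mpr (measure_singleton (μ := volume) (0 : ℝ))
    filter_upwards [hel, ae_comp_neg hel', h0] with x h1 h2 hx0 hx
    rcases lt_or_gt_of_ne hx0 with h | h
    · have h3 := h2 ⟨by linarith, by linarith [hx.1]⟩
      rw [hw, hf.ell_comp_neg, reflection, neg_neg, neg_inj] at h3
      exact h3
    · exact h1 ⟨h, hx.2⟩
  · have hev : ∀ᶠ x in 𝓝[<] Real.pi, x ∈ Ioo 0 Real.pi := Ioo_mem_nhdsLT hpi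
    refine ⟨K + ∫ y in (0 : ℝ)..Real.pi, F y, ?_, ?_⟩
    · refine ((hf.tendsto_halfSolution_pi hε (intervalIntegrable_zero_pi hF)).const_add K).congr' ?_
      filter_upwards [hev] with x hx using (hpos x hx).symm
    · have e : ∫ y in (0 : ℝ)..Real.pi, F y = ∫ y in (0 : ℝ)..Real.pi, reflection F y := by
        rw [integral_circMeasure_eq F hF, sub_eq_zero] at hF0
        exact hF0
      rw [e, hvw]
      refine Tendsto.comp (g := w) (y := 𝓝[<] Real.pi) ?_ (tendsto_neg_nhdsGT_neg Real.pi)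
      refine ((hf.tendsto_halfSolution_pi hε (intervalIntegrable_zero_pi hF')).const_add K).congr' ?_
      filter_upwards [hev] with x hx using (hneg x hx).symm

end Coefficient

/-! ### The graph and the resolvent -/

/-- The constant function `1` in `L²(-π, π)`. -/
noncomputable def oneL2 : L2 := (memLp_const (1 : ℂ)).toLp _

theorem coeFn_oneL2 : (oneL2 : ℝ → ℂ) =ᵐ[circMeasure] fun _ => 1 := MemLp.coeFn_toLp _

/-- The integral over `(-π, π)` as a functional on `L²(-π, π)`. -/
noncomputable def integralL2 : L2 →L[ℂ] ℂ := innerSL ℂ oneL2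

theorem integralL2_apply (F : L2) : integralL2 F = ∫ y, F y ∂circMeasure := by
  change inner ℂ oneL2 F = _
  rw [L2.inner_def]
  refine integral_congr_ae ?_
  filter_upwards [coeFn_oneL2] with y hy
  rw [hy]; simp

theorem integralL2_one_ne_zero : integralL2 oneL2 ≠ 0 := by
  rw [integralL2_apply, integral_congr_ae coeFn_oneL2]
  have h : (circMeasure.real univ : ℂ) ≠ 0 := by
    rw [measureReal_restrict_apply_univ, Real.volume_real_Ioo_of_le (by linarith [Real.pi_pos])]
    have : Real.pi - -Real.pi ≠ 0 := by linarith [Real.pi_pos]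
    exact_mod_cast this
  simpa using h

theorem IsIntegralOperator.congr {G G' : ℝ → ℝ → ℂ} {T : L2 →L[ℂ] L2}
    (hT : IsIntegralOperator G T)
    (hG : ∀ x ∈ Ioo (-Real.pi) Real.pi, ∀ y, G' x y = G x y) : IsIntegralOperator G' T := by
  intro F
  filter_upwards [hT F, ae_restrict_mem measurableSet_Ioo] with x hx hxI
  simpa only [hG x hxI] using hx

namespace Coefficient

variable {f : ℝ → ℝ} (hf : Coefficient f) {ε : ℝ} (hε : 0 < ε)
include hf hε

/-- The operator `L_ε` is determined by the integral operator: its graph consists of the pairs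
`(K + T F, F)` with `F` of mean zero. -/
theorem lGraph_iff {T : L2 →L[ℂ] L2} (hT : IsIntegralOperator (phaseKernel f ε) T) (u F : L2) :
    LGraph f ε u F ↔ (∃ K : ℂ, u = K • oneL2 + T F) ∧ integralL2 F = 0 := by
  have hF : Integrable F circMeasure := L2_integrable F
  have hTF : (T F : ℝ → ℂ) =ᵐ[circMeasure] greenIntegral f ε F := by
    filter_upwards [hT F] with x hx using hx.2
  have hrep : ∀ K : ℂ, ((K • oneL2 + T F : L2) : ℝ → ℂ) =ᵐ[circMeasure]
      fun x => K + greenIntegral f ε F x := fun K => by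
    filter_upwards [Lp.coeFn_add (K • oneL2) (T F), Lp.coeFn_smul K oneL2, coeFn_oneL2, hTF]
      with x h1 h2 h3 h4
    rw [h1, Pi.add_apply, h2, Pi.smul_apply, h3, h4, smul_eq_mul, mul_one]
  rw [integralL2_apply]
  constructor
  · rintro ⟨v, huv, hadm, hv, hell, l, hl, hl'⟩
    obtain ⟨h1, h2⟩ := hf.eq_add_greenIntegral hε hF hadm hv hell hl hl'
    refine ⟨⟨v 0, Lp.ext ?_⟩, h2⟩
    filter_upwards [huv, hrep (v 0), ae_restrict_mem measurableSet_Ioo] with x h3 h4 hx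
    rw [h3, h4, h1 x hx]
  · rintro ⟨⟨K, hu⟩, h0⟩
    refine ⟨fun x => K + greenIntegral f ε F x, hu ▸ hrep K, ?_⟩
    exact hf.isSolution_add_greenIntegral hε hF (L2_integrable_norm_sq F) h0 rfl

/-- The equation (L - z)u = g means u = K + T(g + zu) with g + zu of mean zero. With S = (1 - zT)⁻¹
the first part says u = K S1 + S T g, and the mean condition is then a scalar equation for K with
coefficient z ∫ S1. For small z ≠ 0 the inverse exists and ∫ S1 is near ∫ 1 ≠ 0. -/
theorem exists_isResolvent {T : L2 →L[ℂ] L2} (hT : IsIntegralOperator (phaseKernel f ε) T) :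
    ∃ (z : ℂ) (R : L2 →L[ℂ] L2), IsResolvent f ε z R := by
  have hcont : ContinuousAt (fun z : ℂ => (1 : L2 →L[ℂ] L2) - z • T) 0 := by fun_prop
  have h1 : (1 : L2 →L[ℂ] L2) - (0 : ℂ) • T = ((1 : (L2 →L[ℂ] L2)ˣ) : L2 →L[ℂ] L2) := by simp
  have hunit : ∀ᶠ z : ℂ in 𝓝 0, IsUnit ((1 : L2 →L[ℂ] L2) - z • T) :=
    hcont.eventually_mem (Units.isOpen.mem_nhds (by rw [h1]; exact Units.isUnit _))
  have hinv : ContinuousAt (fun z : ℂ => Ring.inverse ((1 : L2 →L[ℂ] L2) - z • T)) 0 := by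
    refine ContinuousAt.comp (g := Ring.inverse) ?_ hcont
    rw [h1]
    exact NormedRing.inverse_continuousAt _
  have hmean : ContinuousAt
      (fun z : ℂ => integralL2 (Ring.inverse ((1 : L2 →L[ℂ] L2) - z • T) oneL2)) 0 :=
    integralL2.continuous.continuousAt.comp (hinv.clm_apply continuousAt_const)
  have hne : ∀ᶠ z : ℂ in 𝓝 0,
      integralL2 (Ring.inverse ((1 : L2 →L[ℂ] L2) - z • T) oneL2) ≠ 0 := by
    refine hmean.eventually_ne ?_
    rw [h1, Ring.inverse_unit]
    simpa using integralL2_one_ne_zero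
  -- The point z = 0 must be avoided: constants are in the kernel of the operator.
  obtain ⟨z, ⟨hzu, hzm⟩, hz0⟩ :=
    (((hunit.and hne).filter_mono nhdsWithin_le_nhds).and
      (self_mem_nhdsWithin : ({0}ᶜ : Set ℂ) ∈ 𝓝[≠] 0)).exists
  have hz : z ≠ 0 := hz0
  set S := Ring.inverse ((1 : L2 →L[ℂ] L2) - z • T) with hS
  have hS1 : ∀ u : L2, S (u - z • T u) = u := fun u => by
    have := congrArg (fun A : L2 →L[ℂ] L2 => A u) (Ring.inverse_mul_cancel _ hzu)
    simpa using this
  have hS2 : ∀ u : L2, S u - z • T (S u) = u := fun u => by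
    have := congrArg (fun A : L2 →L[ℂ] L2 => A u) (Ring.mul_inverse_cancel _ hzu)
    simpa using this
  set m := integralL2 (S oneL2) with hm
  -- The constant K as a functional of g, solved from the mean condition ∫ g + z (K m + ∫ S T g) =
  -- 0.
  let c : L2 →L[ℂ] ℂ := (-(z * m)⁻¹) • (integralL2 + z • (integralL2 ∘L S ∘L T))
  have hc : ∀ g, z * (c g * m) = -(integralL2 g + z * integralL2 (S (T g))) := fun g => by
    simp only [c, smul_apply, add_apply, ContinuousLinearMap.comp_apply, smul_eq_mul]
    field_simp
  refine ⟨z, c.smulRight (S oneL2) + S ∘L T, fun u g => ?_⟩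
  have hRg : (c.smulRight (S oneL2) + S ∘L T) g = c g • S oneL2 + S (T g) := by simp
  rw [hf.lGraph_iff hε hT, hRg]
  constructor
  · rintro ⟨⟨K, hu⟩, h0⟩
    have e1 : u - z • T u = K • oneL2 + T g := by
      rw [map_add, map_smul] at hu
      rw [sub_eq_iff_eq_add]
      nth_rewrite 1 [hu]
      abel
    have e2 : u = K • S oneL2 + S (T g) := by
      rw [← hS1 u, e1, map_add, map_smul]
    have e3 : K = c g := by
      rw [map_add, map_smul, e2, map_add, map_smul, smul_eq_mul, smul_eq_mul, ← hm] at h0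
      have h4 := hc g
      have h5 : z * m * K = z * m * c g := by linear_combination h0 - h4
      exact mul_left_cancel₀ (mul_ne_zero hz hzm) h5
    rw [e2, e3]
  · intro hu
    refine ⟨⟨c g, ?_⟩, ?_⟩
    · have e1 : u - z • T u = c g • oneL2 + T g := by
        rw [hu, map_add, map_smul, smul_add]
        have h2 := hS2 oneL2
        have h3 := hS2 (T g)
        calc c g • S oneL2 + S (T g) - (z • c g • T (S oneL2) + z • T (S (T g)))
            = c g • (S oneL2 - z • T (S oneL2)) + (S (T g) - z • T (S (T g))) := by module
          _ = _ := by rw [h2, h3]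
      rw [map_add, map_smul]
      rw [sub_eq_iff_eq_add] at e1
      nth_rewrite 1 [e1]
      abel
    · rw [map_add, map_smul, hu, map_add, map_smul, smul_eq_mul, smul_eq_mul, ← hm]
      linear_combination hc g

/-- The description of the graph gives R g = K·1 + T(g + z R g), so R - T(1 + zR) takes values in
the constants and has rank at most one. -/
theorem quadraticApprox_resolvent {T : L2 →L[ℂ] L2}
    (hT : IsIntegralOperator (phaseKernel f ε) T) {z : ℂ} {R : L2 →L[ℂ] L2}
    (hR : IsResolvent f ε z R) : QuadraticApprox R := by
  have hsplit : R = T ∘L (1 + z • R) + (R - T ∘L (1 + z • R)) := by abel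
  rw [hsplit]
  refine ((hf.quadraticApprox_of_kernel hε hT).comp_right _).add_rank (N := 1) ?_
  refine (Submodule.rank_mono (t := Submodule.span ℂ {oneL2}) ?_).trans
    ((rank_span_le _).trans (by simp))
  rintro _ ⟨g, rfl⟩
  obtain ⟨⟨K, hK⟩, -⟩ := (hf.lGraph_iff hε hT _ _).mp ((hR (R g) g).mpr rfl)
  have : (R - T ∘L (1 + z • R) : L2 →L[ℂ] L2) g = K • oneL2 := by
    simp only [sub_apply, ContinuousLinearMap.comp_apply, add_apply, smul_apply,
      one_apply_eq_self]
    nth_rewrite 1 [hK]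
    abel
  change (R - T ∘L (1 + z • R) : L2 →L[ℂ] L2) g ∈ _
  rw [this]
  exact Submodule.smul_mem _ _ (Submodule.mem_span_singleton_self _)

end Coefficient

end SingularSL

/-! ### The theorem -/

theorem theorem3p1 (f : ℝ → ℝ) (hf : SingularSL.Coefficient f)
    (ε : ℝ) (hε_pos : 0 < ε) (hε_lt : ε < 2 / deriv f 0)
    (cp cm : ℂ) (hcp : cp ≠ 0) (hcm : cm ≠ 0) :
    (∃ T : SingularSL.L2 →L[ℂ] SingularSL.L2,
      SingularSL.IsIntegralOperator (SingularSL.greenKernel f ε cp cm) T ∧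
        ∀ p : ℝ, 2 / 3 < p → SingularSL.IsSchatten p T) ∧
    (∃ (z : ℂ) (R : SingularSL.L2 →L[ℂ] SingularSL.L2), SingularSL.IsResolvent f ε z R) ∧
    (∀ (z : ℂ) (R : SingularSL.L2 →L[ℂ] SingularSL.L2), SingularSL.IsResolvent f ε z R →
      ∀ p : ℝ, 2 / 3 < p → SingularSL.IsSchatten p R) := by
  obtain ⟨T, hT⟩ : ∃ T : SingularSL.L2 →L[ℂ] SingularSL.L2,
      SingularSL.IsIntegralOperator (SingularSL.phaseKernel f ε) T :=
    SingularSL.exists_kernel_operator (hf.measurable_phaseKernel hε_pos)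
      (hf.norm_phaseKernel_le hε_pos)
  refine ⟨⟨T, hT.congr fun x hx y => hf.greenKernel_eq hε_pos hcp hcm hx y, fun p hp => ?_⟩,
    hf.exists_isResolvent hε_pos hT, fun z R hR p hp => ?_⟩
  -- The approximation rate needs only p > 1/2, and 1/2 < 2/3.
  · exact (hf.quadraticApprox_of_kernel hε_pos hT).isSchatten (by linarith)
  · exact (hf.quadraticApprox_resolvent hε_pos hT hR).isSchatten (by linarith)
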